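/- Let $p\ge 1$ be real and let $f$ be a probability distribution on $\mathbb{R}$ with mean zero, finite variance $\sigma_f^2>0$, and finite absolute moment $\mu_{f,p}:=\mathbb{E}_{X\sim f}[|X|^p]<\infty$. Put $\tilde\mu_{f,p}:=\mathbb{E}_{X\sim\mathcal{N}(0,\sigma_f^4)}[|X|^p]$, where $\mathcal N(0,\sigma_f^4)$ is the centred normal distribution with variance $\sigma_f^4$. For all positive integers $m,n$ let $A\in\mathbb{R}^{m\times n}$ and $x\in\mathbb{R}^n$ be random, such that the $mn+n$ entries of $A$ and $x$ are i.i.d. with distribution $f$, and let $$M(p):=n^{p-1}\,\frac{\sum_{j=1}^n\|x_jA^{(j)}\|_p^p}{\|Ax\|_p^p},$$ where $A^{(j)}$ is the $j$-th column of $A$ and $\|v\|_p^p=\sum_i|v_i|^p$ (with the convention $M(p):=0$ when $Ax=0$). Then, as $m,n\to\infty$ jointly, $$\frac{M(p)}{n^{p/2}}\longrightarrow\frac{\mu_{f,p}^2}{\tilde\mu_{f,p}}\quad\text{in probability},$$ that is, for every $\varepsilon>0$ and $\delta>0$ there is $N$ such that $\Pr\left(\left|M(p)/n^{p/2}-\mu_{f,p}^2/\tilde\mu_{f,p}\right|\ge\varepsilon\right)\le\delta$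 for all $m,n\ge N$. -/

import Mathlib

open MeasureTheory ProbabilityTheory Filter
open scoped Matrix Topology

noncomputable section

/-- The `L^p` norm `‖v‖_p` of a real vector (Mathlib's norm on `PiLp`). -/
def lpNormVec {ι : Type*} [Fintype ι] (p : ℝ) (v : ι → ℝ) : ℝ :=
  ‖WithLp.toLp (ENNReal.ofReal p) v‖

/-- `M(p) = n^(p-1) * (∑_j ‖x_j A^(j)‖_p^p) / ‖A x‖_p^p`, where `A^(j)` is the `j`-th column
of the `m × n` matrix `A`. -/
def queryFactor {m n : ℕ} (p : ℝ) (A : Matrix (Fin m) (Fin n) ℝ) (x : Fin n → ℝ) : ℝ :=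
  (n : ℝ) ^ (p - 1) *
    ((∑ j, lpNormVec p (x j • A.col j) ^ p) / lpNormVec p (A *ᵥ x) ^ p)

/-- `μ_{f,p} = E_{X ∼ f} |X|^p`. -/
def absMoment (f : Measure ℝ) (p : ℝ) : ℝ :=
  ∫ y, |y| ^ p ∂f

/-- `μ̃_{f,p} = E_{X ∼ N(0, σ_f^4)} |X|^p`, where `σ_f^2` is the variance of the law `f`. -/
def gaussAbsMoment (f : Measure ℝ) (p : ℝ) : ℝ :=
  absMoment (gaussianReal 0 (Var[id; f] ^ 2).toNNReal) p

/-- All the entries of the random matrix `A` and of the random vector `x`, taken together, are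
independent random variables, each of them with law `f`. -/
structure IIDEntries {Ω : Type*} [MeasurableSpace Ω] (P : Measure Ω) (f : Measure ℝ) {m n : ℕ}
    (A : Ω → Matrix (Fin m) (Fin n) ℝ) (x : Ω → Fin n → ℝ) : Prop where
  law_matrix : ∀ i j, HasLaw (fun ω => A ω i j) f P
  law_vector : ∀ j, HasLaw (fun ω => x ω j) f P
  indep : iIndepFun
    (Sum.elim (fun (ij : Fin m × Fin n) (ω : Ω) => A ω ij.1 ij.2) (fun (j : Fin n) (ω : Ω) => x ω j)) P

end

-- Cancelling powers of `n` turns `M(p) / n^(p/2)` into a quotient of two averages. The numerator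
-- averages `|x_j|^p |A_ij|^p` over all `i, j`; the denominator averages `|T_i|^p` over the rows,
-- where `T_i = n^(-1/2) ∑_j A_ij x_j`. Each converges in mean to a constant, hence in probability,
-- and the limit of the denominator is positive, so the quotient converges.
--
-- The numerator needs only the law of large numbers, applied within columns and then to `x`
-- (`integral_abs_numerator_sub_le`, `tendsto_averageDeviation`).
--
-- The denominator is the hard part: all `T_i` share `x`, so they are not independent. For two rows,
-- however, `(T_i, T_i')` is a normalised sum of i.i.d. planar vectors `(a z, b z)`, whose
-- coordinates are uncorrelated with variance `σ_f^4`. By the planar central limit theorem the pair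
-- becomes a pair of independent Gaussians, so bounded functions of distinct rows decorrelate
-- (`tendsto_integral_mul_planarSum`) and a second-moment estimate controls their average
-- (`integral_abs_average_le`). Since `|T|^p` is unbounded, it is truncated at a level `K`; the
-- excess is small in mean uniformly in `n` (`exists_integral_abs_rpow_sub_min_le`), by a
-- Marcinkiewicz–Zygmund inequality. Only the `p`-th moment is available, so uniform integrability
-- comes from splitting each summand into a bounded part and a part small in `L^q`, `q = max p 2`.

universe u

/-! ### Moment inequality for sums of independent centred variables -/

/-- The exact first-order term is kept because it will integrate to zero. For small `t`, Bernoulli's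
inequality bounds `(1 + t)^(-q)` from below; for large `t`, the last term dominates. -/
lemma abs_one_add_rpow_le {q : ℝ} (hq : 2 ≤ q) (t : ℝ) :
    |1 + t| ^ q ≤ 1 + q * t + 2 * q ^ 2 * t ^ 2 + (1 + 2 * q) ^ q * |t| ^ q := by
  have hR : 0 ≤ (1 + 2 * q) ^ q * |t| ^ q := by positivity
  rcases le_total (|t| * (2 * q)) 1 with ht | ht
  · have h1 : |t| ≤ 1 / 4 := by nlinarith [abs_nonneg t]
    obtain ⟨h2, h3⟩ := abs_le.1 h1
    have h4 : (q - 1) * t ≤ 1 / 2 := by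
      nlinarith [le_abs_self t, abs_nonneg t]
    have hpos : 0 < 1 + t := by linarith
    have hs : -1 ≤ -t / (1 + t) := by rw [le_div_iff₀ hpos]; linarith
    have hb := one_add_mul_self_le_rpow_one_add hs (by linarith : 1 ≤ q)
    have e1 : 1 + -t / (1 + t) = (1 + t)⁻¹ := by field_simp; ring
    rw [e1, Real.inv_rpow hpos.le] at hb
    rw [abs_of_pos hpos]
    set u := (1 + t) ^ q
    have hu : 0 < u := by positivity
    have h5 : (1 + t - q * t) * u ≤ 1 + t := by
      have h6 := mul_le_mul_of_nonneg_right (mul_le_mul_of_nonneg_right hb hu.le) hpos.le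
      rw [inv_mul_cancel₀ hu.ne'] at h6
      have e2 : (1 + q * (-t / (1 + t))) * u * (1 + t) = (1 + t - q * t) * u := by
        field_simp; ring
      linarith
    have h7 : u ≤ 1 + q * t + 2 * q ^ 2 * t ^ 2 := by
      have hd : 0 < 1 + t - q * t := by linarith
      refine le_of_mul_le_mul_left (h5.trans ?_) hd
      -- The right side of the goal minus its left is exactly `q t²` plus this quantity.
      have h8 : 0 ≤ (q ^ 2 * t ^ 2) * (1 - 2 * ((q - 1) * t)) := by
        apply mul_nonneg (by positivity); linarith
      nlinarith [mul_nonneg (by linarith : (0 : ℝ) ≤ q) (sq_nonneg t)]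
    linarith
  · have h1 : |1 + t| ≤ (1 + 2 * q) * |t| := by
      calc |1 + t| ≤ |1| + |t| := abs_add_le _ _
        _ ≤ _ := by rw [abs_one]; nlinarith
    have h2 : |1 + t| ^ q ≤ (1 + 2 * q) ^ q * |t| ^ q := by
      rw [← Real.mul_rpow (by linarith) (abs_nonneg t)]
      exact Real.rpow_le_rpow (abs_nonneg _) h1 (by linarith)
    have h3 : 0 ≤ 1 + q * t + 2 * q ^ 2 * t ^ 2 := by nlinarith [sq_nonneg (1 + 2 * (q * t))]
    linarith

lemma abs_rpow_eq_mul_sq {q : ℝ} {a : ℝ} (ha : a ≠ 0) : |a| ^ q = |a| ^ (q - 2) * a ^ 2 := by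
  have h : 0 < |a| := abs_pos.2 ha
  rw [← sq_abs a, ← Real.rpow_natCast, ← Real.rpow_add h]; norm_num

lemma abs_add_rpow_le {q : ℝ} (hq : 2 ≤ q) (a b : ℝ) :
    |a + b| ^ q ≤ |a| ^ q + q * (a * |a| ^ (q - 2) * b) + 2 * q ^ 2 * (|a| ^ (q - 2) * b ^ 2)
      + (1 + 2 * q) ^ q * |b| ^ q := by
  rcases eq_or_ne a 0 with rfl | ha
  · have h1 : (1 : ℝ) ≤ (1 + 2 * q) ^ q := Real.one_le_rpow (by linarith) (by linarith)
    have h2 : 0 ≤ 2 * q ^ 2 * (|(0 : ℝ)| ^ (q - 2) * b ^ 2) := by positivity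
    have h3 : (0 : ℝ) ≤ |0| ^ q := by positivity
    have h4 : 0 ≤ |b| ^ q := by positivity
    simp only [zero_add, zero_mul, mul_zero, add_zero]
    nlinarith
  · have h := mul_le_mul_of_nonneg_left (abs_one_add_rpow_le hq (b / a))
      (by positivity : 0 ≤ |a| ^ q)
    have e1 : |a| ^ q * |1 + b / a| ^ q = |a + b| ^ q := by
      rw [← Real.mul_rpow (abs_nonneg _) (abs_nonneg _), ← abs_mul]
      congr 2; field_simp
    have e2 : |a| ^ q * |b / a| ^ q = |b| ^ q := by
      rw [← Real.mul_rpow (abs_nonneg _) (abs_nonneg _), ← abs_mul]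
      congr 2; field_simp
    rw [e1] at h
    refine h.trans (le_of_eq ?_)
    calc _ = |a| ^ q + q * (|a| ^ q * (b / a)) + 2 * q ^ 2 * (|a| ^ q * (b / a) ^ 2)
        + (1 + 2 * q) ^ q * (|a| ^ q * |b / a| ^ q) := by ring
      _ = _ := by
        rw [e2, abs_rpow_eq_mul_sq (q := q) ha]; field_simp

/-- The constant in `abs_add_rpow_le_of_one_le`. -/
noncomputable def mzConst (q : ℝ) : ℝ := 2 * q ^ 2 * (4 * q ^ 2) ^ (q / 2 - 1) + (1 + 2 * q) ^ q

lemma mzConst_pos {q : ℝ} (hq : 2 ≤ q) : 0 < mzConst q := by unfold mzConst; positivity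

/-- The quadratic term is absorbed on one side or the other, according to whether `a²` exceeds `4 q²
k b²`. With `k` the number of terms already summed, the factor `1 + 1/(2k)` is small enough for an
induction with growth `k^(q/2)`. -/
lemma abs_add_rpow_le_of_one_le {q k : ℝ} (hq : 2 ≤ q) (hk : 1 ≤ k) (a b : ℝ) :
    |a + b| ^ q ≤ (1 + 1 / (2 * k)) * |a| ^ q + q * (a * |a| ^ (q - 2) * b)
      + mzConst q * k ^ (q / 2 - 1) * |b| ^ q := by
  refine (abs_add_rpow_le hq a b).trans ?_
  have hk1 : 1 ≤ k ^ (q / 2 - 1) := Real.one_le_rpow hk (by linarith)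
  have hB : 0 ≤ |b| ^ q := by positivity
  have h0 : (1 + 2 * q) ^ q * |b| ^ q ≤ (1 + 2 * q) ^ q * k ^ (q / 2 - 1) * |b| ^ q := by
    gcongr
    exact le_mul_of_one_le_right (by positivity) hk1
  suffices h : 2 * q ^ 2 * (|a| ^ (q - 2) * b ^ 2) ≤ 1 / (2 * k) * |a| ^ q
      + 2 * q ^ 2 * (4 * q ^ 2) ^ (q / 2 - 1) * k ^ (q / 2 - 1) * |b| ^ q by
    unfold mzConst; linarith
  have hA : 0 ≤ |a| ^ q := by positivity
  rcases eq_or_ne b 0 with rfl | hb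
  · have : 0 ≤ 2 * q ^ 2 * (4 * q ^ 2) ^ (q / 2 - 1) * k ^ (q / 2 - 1) * |(0 : ℝ)| ^ q := by
      positivity
    have : 0 ≤ 1 / (2 * k) * |a| ^ q := by positivity
    simp only [ne_eq, OfNat.ofNat_ne_zero, not_false_eq_true, zero_pow, mul_zero]
    linarith
  rcases le_total (4 * q ^ 2 * k * b ^ 2) (a ^ 2) with h | h
  · have ha : a ≠ 0 := by
      rintro rfl
      have : 0 < 4 * q ^ 2 * k * b ^ 2 := by positivity
      nlinarith
    have h2 : 0 ≤ 2 * q ^ 2 * (4 * q ^ 2) ^ (q / 2 - 1) * k ^ (q / 2 - 1) * |b| ^ q := by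
      positivity
    have h3 : 2 * q ^ 2 * (|a| ^ (q - 2) * b ^ 2) ≤ 1 / (2 * k) * |a| ^ q := by
      rw [abs_rpow_eq_mul_sq (q := q) ha]
      have : 2 * q ^ 2 * b ^ 2 ≤ 1 / (2 * k) * a ^ 2 := by
        rw [one_div, inv_mul_eq_div, le_div_iff₀ (by linarith)]; linarith
      calc _ = |a| ^ (q - 2) * (2 * q ^ 2 * b ^ 2) := by ring
        _ ≤ |a| ^ (q - 2) * (1 / (2 * k) * a ^ 2) := by gcongr
        _ = _ := by ring
    linarith
  · have h2 : |a| ^ (q - 2) ≤ (4 * q ^ 2 * k) ^ (q / 2 - 1) * |b| ^ (q - 2) := by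
      have key : ∀ z : ℝ, |z| ^ (q - 2) = (z ^ 2) ^ (q / 2 - 1) := by
        intro z
        rw [← sq_abs, ← Real.rpow_natCast, ← Real.rpow_mul (abs_nonneg z)]
        congr 1; push_cast; ring
      rw [key, key, ← Real.mul_rpow (by positivity) (by positivity)]
      exact Real.rpow_le_rpow (by positivity) h (by linarith)
    have h3 : 0 ≤ 1 / (2 * k) * |a| ^ q := by positivity
    rw [abs_rpow_eq_mul_sq (q := q) hb]
    rw [Real.mul_rpow (by positivity) (by positivity)] at h2
    have h4 := mul_le_mul_of_nonneg_left (mul_le_mul_of_nonneg_right h2 (sq_nonneg b))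
      (by positivity : 0 ≤ 2 * q ^ 2)
    linarith

lemma memLp_iff_integrable_abs_rpow {Ω : Type*} [MeasurableSpace Ω] {P : Measure Ω} {q : ℝ}
    (hq : 0 < q) {X : Ω → ℝ} (hX : AEStronglyMeasurable X P) :
    MemLp X (ENNReal.ofReal q) P ↔ Integrable (fun ω => |X ω| ^ q) P := by
  rw [← integrable_norm_rpow_iff hX (by simpa using hq) (by simp)]
  simp [ENNReal.toReal_ofReal hq.le]

/-- A Marcinkiewicz–Zygmund inequality for sums of independent centred random variables. -/
lemma integral_abs_sum_rpow_le {Ω ι : Type*} [MeasurableSpace Ω] {P : Measure Ω}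
    [IsProbabilityMeasure P] {q : ℝ} (hq : 2 ≤ q) {Y : ι → Ω → ℝ} (hY : iIndepFun Y P)
    (hmem : ∀ i, MemLp (Y i) (ENNReal.ofReal q) P) (h0 : ∀ i, ∫ ω, Y i ω ∂P = 0) {B : ℝ}
    (hB : ∀ i, ∫ ω, |Y i ω| ^ q ∂P ≤ B) (s : Finset ι) :
    ∫ ω, |∑ i ∈ s, Y i ω| ^ q ∂P ≤ 2 * mzConst q * (s.card : ℝ) ^ (q / 2) * B := by
  classical
  have hq0 : 0 < q := by linarith
  have hq1 : (1 : ENNReal) ≤ ENNReal.ofReal q := by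
    rw [← ENNReal.ofReal_one]; exact ENNReal.ofReal_le_ofReal (by linarith)
  have hC := mzConst_pos hq
  have hsum : ∀ s : Finset ι, MemLp (fun ω => ∑ i ∈ s, Y i ω) (ENNReal.ofReal q) P :=
    fun s => memLp_finsetSum _ fun i _ => hmem i
  have hint : ∀ {Z : Ω → ℝ}, MemLp Z (ENNReal.ofReal q) P → Integrable (fun ω => |Z ω| ^ q) P :=
    fun hZ => (memLp_iff_integrable_abs_rpow hq0 hZ.1).1 hZ
  induction s using Finset.induction_on with
  | empty => simp [Real.zero_rpow hq0.ne', Real.zero_rpow (by linarith : q / 2 ≠ 0)]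
  | insert i s his ih =>
    have hB0 : 0 ≤ B := (integral_nonneg fun _ => by positivity).trans (hB i)
    rcases s.eq_empty_or_nonempty with rfl | hs
    · simp only [insert_empty_eq, Finset.sum_singleton, Finset.card_singleton, Nat.cast_one,
        Real.one_rpow, mul_one]
      have : 1 ≤ 2 * mzConst q := by
        have h1 : (1 : ℝ) ≤ (1 + 2 * q) ^ q := Real.one_le_rpow (by linarith) (by linarith)
        have h2 : 0 ≤ 2 * q ^ 2 * (4 * q ^ 2) ^ (q / 2 - 1) := by positivity
        unfold mzConst; linarith
      nlinarith [hB i]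
    set S : Ω → ℝ := fun ω => ∑ i ∈ s, Y i ω with hS
    set k : ℝ := (s.card : ℝ) with hkdef
    have hk : 1 ≤ k := by
      have := hs.card_pos
      rw [hkdef]; exact_mod_cast this
    have hind : IndepFun S (Y i) P := by
      have := hY.indepFun_finsetSum_of_notMem₀ (fun i => (hmem i).1.aemeasurable) his
      convert this using 1
      ext ω; simp [hS]
    have hψ : Measurable (fun z : ℝ => z * |z| ^ (q - 2)) := by fun_prop
    have hSψ : Integrable (fun ω => S ω * |S ω| ^ (q - 2)) P := by
      have h1 : Integrable (fun ω => |S ω| ^ (q - 1)) P := by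
        refine (memLp_iff_integrable_abs_rpow (by linarith) (hsum s).1).1 ?_
        exact (hsum s).mono_exponent (ENNReal.ofReal_le_ofReal (by linarith))
      refine h1.mono' (hψ.comp_aemeasurable (hsum s).1.aemeasurable).aestronglyMeasurable
        (ae_of_all _ fun ω => ?_)
      rw [Real.norm_eq_abs, abs_mul, abs_of_nonneg (by positivity : 0 ≤ |S ω| ^ (q - 2))]
      rcases eq_or_ne (S ω) 0 with h | h
      · simp [h, Real.zero_rpow (by linarith : q - 1 ≠ 0)]
      · nth_rewrite 1 [← Real.rpow_one |S ω|]
        rw [← Real.rpow_add (abs_pos.2 h)]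
        apply le_of_eq; congr 1; ring
    have hYi : Integrable (Y i) P := (hmem i).integrable hq1
    have hind' : IndepFun (fun ω => S ω * |S ω| ^ (q - 2)) (Y i) P :=
      hind.comp hψ measurable_id
    have hcross : Integrable (fun ω => S ω * |S ω| ^ (q - 2) * Y i ω) P :=
      hind'.integrable_mul hSψ hYi
    -- The first-order term vanishes: a function of `S` times an independent centred variable.
    have hcross0 : ∫ ω, S ω * |S ω| ^ (q - 2) * Y i ω ∂P = 0 := by
      have := hind'.integral_fun_mul_eq_mul_integral hSψ.1 hYi.1
      rw [this, h0, mul_zero]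
    have hle : ∫ ω, |∑ j ∈ insert i s, Y j ω| ^ q ∂P ≤ (1 + 1 / (2 * k)) * ∫ ω, |S ω| ^ q ∂P
        + mzConst q * k ^ (q / 2 - 1) * ∫ ω, |Y i ω| ^ q ∂P := by
      calc _ ≤ ∫ ω, ((1 + 1 / (2 * k)) * |S ω| ^ q + q * (S ω * |S ω| ^ (q - 2) * Y i ω)
            + mzConst q * k ^ (q / 2 - 1) * |Y i ω| ^ q) ∂P := by
            refine integral_mono (hint (hsum _)) ((((hint (hsum s)).const_mul _).add
              (hcross.const_mul _)).add ((hint (hmem i)).const_mul _)) fun ω => ?_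
            simp only [Finset.sum_insert his]
            rw [add_comm]
            exact abs_add_rpow_le_of_one_le hq hk _ _
        _ = _ := by
            have i1 : Integrable (fun ω => (1 + 1 / (2 * k)) * |S ω| ^ q) P :=
              (hint (hsum s)).const_mul _
            have i2 : Integrable (fun ω => q * (S ω * |S ω| ^ (q - 2) * Y i ω)) P :=
              hcross.const_mul _
            have i3 : Integrable (fun ω => (1 + 1 / (2 * k)) * |S ω| ^ q
              + q * (S ω * |S ω| ^ (q - 2) * Y i ω)) P := i1.add i2
            rw [integral_add i3 ((hint (hmem i)).const_mul _), integral_add i1 i2,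
              integral_const_mul, integral_const_mul, integral_const_mul, hcross0, mul_zero,
              add_zero]
    refine hle.trans ?_
    rw [Finset.card_insert_of_notMem his]
    push_cast
    rw [← hkdef]
    have hk0 : 0 < k := by linarith
    have hber : (1 + 1 / k) ≤ (1 + 1 / k) ^ (q / 2) := by
      have := one_add_mul_self_le_rpow_one_add (s := 1 / k)
        (by have : 0 < 1 / k := by positivity
            linarith) (by linarith : 1 ≤ q / 2)
      have h2 : 1 / k ≤ q / 2 * (1 / k) := le_mul_of_one_le_left (by positivity) (by linarith)
      linarith
    have hk2 : (k + 1) ^ (q / 2) = k ^ (q / 2) * (1 + 1 / k) ^ (q / 2) := by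
      rw [← Real.mul_rpow hk0.le (by positivity)]
      congr 1; field_simp
    have hk3 : k ^ (q / 2 - 1) = k ^ (q / 2) * (1 / k) := by
      rw [Real.rpow_sub hk0, Real.rpow_one]; ring
    -- The factor 2 in the bound closes the induction: the growth of the old sum and the new term
    -- each contribute `mzConst q * k^(q/2 - 1) * B`.
    calc _ ≤ (1 + 1 / (2 * k)) * (2 * mzConst q * k ^ (q / 2) * B)
          + mzConst q * k ^ (q / 2 - 1) * B := by gcongr; exact hB i
      _ = 2 * mzConst q * (k ^ (q / 2) * (1 + 1 / k)) * B := by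
          rw [hk3]; field_simp; ring
      _ ≤ _ := by rw [hk2]; gcongr

lemma integral_abs_inv_sqrt_mul_sum_rpow_le {Ω : Type*} [MeasurableSpace Ω] {P : Measure Ω}
    [IsProbabilityMeasure P] {q : ℝ} (hq : 2 ≤ q) {n : ℕ} {Y : Fin n → Ω → ℝ}
    (hY : iIndepFun Y P) (hmem : ∀ i, MemLp (Y i) (ENNReal.ofReal q) P)
    (h0 : ∀ i, ∫ ω, Y i ω ∂P = 0) {B : ℝ} (hB0 : 0 ≤ B)
    (hB : ∀ i, ∫ ω, |Y i ω| ^ q ∂P ≤ B) :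
    ∫ ω, |(√(n : ℝ))⁻¹ * ∑ i, Y i ω| ^ q ∂P ≤ 2 * mzConst q * B := by
  have hC := mzConst_pos hq
  rcases n.eq_zero_or_pos with rfl | hn
  · simp [Real.zero_rpow (by linarith : q ≠ 0)]
    positivity
  have h := integral_abs_sum_rpow_le hq hY hmem h0 hB Finset.univ
  have e : ∀ ω, |(√(n : ℝ))⁻¹ * ∑ i, Y i ω| ^ q
      = ((n : ℝ) ^ (q / 2))⁻¹ * |∑ i, Y i ω| ^ q := by
    intro ω
    rw [abs_mul, Real.mul_rpow (abs_nonneg _) (abs_nonneg _), abs_inv,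
      abs_of_nonneg (Real.sqrt_nonneg _), Real.inv_rpow (Real.sqrt_nonneg _), Real.sqrt_eq_rpow,
      ← Real.rpow_mul (by positivity)]
    congr 3; ring
  simp_rw [e]
  rw [integral_const_mul, inv_mul_le_iff₀ (by positivity)]
  rw [Finset.card_univ, Fintype.card_fin] at h
  linarith

/-! ### Truncation and uniform integrability -/

/-- Take a simple function close in `L^q` and subtract its mean, which is no larger than the
approximation error because `ν` is centred. Each of the two errors gets half of `δ^(1/q)`. -/
lemma exists_bounded_centered_approx {ν : Measure ℝ} [IsProbabilityMeasure ν] {q : ℝ} (hq : 1 ≤ q)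
    (hmem : MemLp id (ENNReal.ofReal q) ν) (h0 : ∫ y, y ∂ν = 0) {δ : ℝ} (hδ : 0 < δ) :
    ∃ h : ℝ → ℝ, Measurable h ∧ (∃ R, ∀ y, |h y| ≤ R) ∧ ∫ y, h y ∂ν = 0 ∧
      ∫ y, |y - h y| ^ q ∂ν ≤ δ := by
  have hq0 : 0 < q := by linarith
  have hq1 : (1 : ENNReal) ≤ ENNReal.ofReal q := by
    rw [← ENNReal.ofReal_one]; exact ENNReal.ofReal_le_ofReal hq
  set η : ℝ := δ ^ q⁻¹ / 2 with hη
  have hηpos : 0 < η := by positivity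
  obtain ⟨g, hg, hgmem⟩ := hmem.exists_simpleFunc_eLpNorm_sub_lt (by simp)
    (ε := ENNReal.ofReal η) (by simpa using hηpos)
  change eLpNorm (fun y => y - g y) _ ν < _ at hg
  set c := ∫ y, g y ∂ν with hc
  have hgi : Integrable g ν := hgmem.integrable hq1
  have hidi : Integrable (fun y : ℝ => y) ν := hmem.integrable hq1
  have hcle : ENNReal.ofReal |c| ≤ ENNReal.ofReal η := by
    have e : c = -∫ y, (y - g y) ∂ν := by
      have : ∫ y, (y - g y) ∂ν = ∫ y, y ∂ν - ∫ y, g y ∂ν := integral_sub hidi hgi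
      rw [this, h0, hc]; ring
    calc ENNReal.ofReal |c| = ‖∫ y, (y - g y) ∂ν‖ₑ := by
          rw [e, abs_neg, ← Real.norm_eq_abs, ofReal_norm]
      _ ≤ eLpNorm (fun y => y - g y) 1 ν := by
          rw [eLpNorm_one_eq_lintegral_enorm]; exact enorm_integral_le_lintegral_enorm _
      _ ≤ eLpNorm (fun y => y - g y) (ENNReal.ofReal q) ν :=
          eLpNorm_le_eLpNorm_of_exponent_le hq1 (hmem.1.sub hgmem.1)
      _ ≤ _ := hg.le
  obtain ⟨R, hR⟩ := g.exists_forall_norm_le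
  refine ⟨fun y => g y - c, g.measurable.sub_const c, ⟨R + |c|, fun y => ?_⟩, ?_, ?_⟩
  · exact (abs_sub _ _).trans (add_le_add_left (hR y) _)
  · rw [integral_sub hgi (integrable_const c)]; simp [hc]
  · have hmem2 : MemLp (fun y : ℝ => y - (g y - c)) (ENNReal.ofReal q) ν :=
      hmem.sub (hgmem.sub (memLp_const c))
    have hle : eLpNorm (fun y : ℝ => y - (g y - c)) (ENNReal.ofReal q) ν
        ≤ ENNReal.ofReal (δ ^ q⁻¹) := by
      have e : (fun y : ℝ => y - (g y - c)) = (fun y => y - g y) + fun _ => c := by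
        ext y; simp only [Pi.add_apply]; ring
      rw [e]
      refine (eLpNorm_add_le (hmem.1.sub hgmem.1) aestronglyMeasurable_const hq1).trans ?_
      rw [eLpNorm_const c (by simpa using hq0) (IsProbabilityMeasure.ne_zero ν)]
      simp only [measure_univ, ENNReal.one_rpow, mul_one]
      rw [← ofReal_norm, Real.norm_eq_abs]
      refine (add_le_add hg.le hcle).trans ?_
      rw [← ENNReal.ofReal_add hηpos.le hηpos.le, hη, add_halves]
    rw [hmem2.eLpNorm_eq_integral_rpow_norm (by simpa using hq0) (by simp),
      ENNReal.toReal_ofReal hq0.le, ENNReal.ofReal_le_ofReal_iff (by positivity)] at hle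
    exact (Real.rpow_le_rpow_iff (integral_nonneg fun _ => by positivity) hδ.le
      (by positivity)).1 hle

/-- Here `a` is the part with `2q` moments and `b` the part small in `L^q`. Truncating at `K + 1`
rather than `K` ensures `|a + b| ≥ 1` wherever the excess is nonzero, so `p` may be raised to `q`.
-/
lemma abs_rpow_sub_min_le {p q K : ℝ} (hp : 0 ≤ p) (hpq : p ≤ q) (hK : 0 < K) (a b : ℝ) :
    |a + b| ^ p - min (|a + b| ^ p) (K + 1)
      ≤ 2 ^ q * |b| ^ q + 4 ^ q * |a| ^ (2 * q) / K := by
  have hq : 0 ≤ q := hp.trans hpq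
  have hR : 0 ≤ 2 ^ q * |b| ^ q + 4 ^ q * |a| ^ (2 * q) / K := by positivity
  rcases le_total (|a + b| ^ p) (K + 1) with h | h
  · rw [min_eq_left h, sub_self]; exact hR
  rw [min_eq_right h]
  have h1 : 1 ≤ |a + b| := by
    by_contra hc
    have := Real.rpow_le_one (abs_nonneg (a + b)) (not_le.1 hc).le hp
    linarith
  have h2 : |a + b| ^ p ≤ |a + b| ^ q := Real.rpow_le_rpow_of_exponent_le h1 hpq
  have h3 : |a + b| ^ q ≤ 2 ^ q * |a| ^ q + 2 ^ q * |b| ^ q := by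
    have ha : 0 ≤ 2 ^ q * |a| ^ q := by positivity
    have hb : 0 ≤ 2 ^ q * |b| ^ q := by positivity
    rcases le_total |a| |b| with hab | hab
    · have : |a + b| ^ q ≤ (2 * |b|) ^ q := by
        refine Real.rpow_le_rpow (abs_nonneg _) ?_ hq
        linarith [abs_add_le a b]
      rw [Real.mul_rpow (by norm_num) (abs_nonneg _)] at this
      linarith
    · have : |a + b| ^ q ≤ (2 * |a|) ^ q := by
        refine Real.rpow_le_rpow (abs_nonneg _) ?_ hq
        linarith [abs_add_le a b]
      rw [Real.mul_rpow (by norm_num) (abs_nonneg _)] at this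
      linarith
  have h4 : 2 ^ q * |a| ^ q - K ≤ 4 ^ q * |a| ^ (2 * q) / K := by
    have e1 : (4 : ℝ) ^ q = 2 ^ q * 2 ^ q := by
      rw [← Real.mul_rpow (by norm_num) (by norm_num)]; norm_num
    have e2 : |a| ^ (2 * q) = |a| ^ q * |a| ^ q := by
      rw [mul_comm, Real.rpow_mul (abs_nonneg _), Real.rpow_two, sq]
    rw [e1, e2, le_div_iff₀ hK]
    nlinarith [sq_nonneg (2 ^ q * |a| ^ q - K)]
  linarith

/-- Uniform integrability of `|n^{-1/2} ∑ Y_i|^p` for i.i.d. centred `Y_i`. -/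
lemma exists_integral_abs_rpow_sub_min_le {ν : Measure ℝ} [IsProbabilityMeasure ν] {p q : ℝ}
    (hp : 0 ≤ p) (hpq : p ≤ q) (hq : 2 ≤ q) (hmem : MemLp id (ENNReal.ofReal q) ν)
    (h0 : ∫ y, y ∂ν = 0) {ε : ℝ} (hε : 0 < ε) :
    ∃ K₀ : ℝ, ∀ K, K₀ ≤ K → ∀ {Ω : Type u} [MeasurableSpace Ω] {P : Measure Ω}
      [IsProbabilityMeasure P] {n : ℕ}
      {Y : Fin n → Ω → ℝ}, iIndepFun Y P → (∀ i, HasLaw (Y i) ν P) →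
      ∫ ω, (|(√(n : ℝ))⁻¹ * ∑ i, Y i ω| ^ p - min (|(√(n : ℝ))⁻¹ * ∑ i, Y i ω| ^ p) K) ∂P ≤ ε := by
  have hC := mzConst_pos hq
  have hC2 := mzConst_pos (by linarith : 2 ≤ 2 * q)
  set δ := ε / 2 / (2 ^ q * (2 * mzConst q)) with hδ
  have hδ0 : 0 < δ := by positivity
  obtain ⟨h, hh, ⟨R, hR⟩, hh0, hhδ⟩ := exists_bounded_centered_approx (by linarith) hmem h0 hδ0
  have hR0 : 0 ≤ R := (abs_nonneg _).trans (hR 0)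
  have hhi : Integrable h ν := Integrable.of_bound hh.aestronglyMeasurable R (ae_of_all _ hR)
  have hidi : Integrable (fun y : ℝ => y) ν := hmem.integrable (by
    rw [← ENNReal.ofReal_one]; exact ENNReal.ofReal_le_ofReal (by linarith))
  set M := 4 ^ q * (2 * mzConst (2 * q) * R ^ (2 * q)) with hM
  have hM0 : 0 ≤ M := by positivity
  -- `2M/ε` makes the bounded part cost at most `ε/2`, one `1` keeps `K` positive, the other is the
  -- shift `K' = K + 1`. Nothing here depends on `n` or on the probability space.
  refine ⟨2 * M / ε + 1 + 1, fun K' hK' {Ω} _ P _ n Y hY hlaw => ?_⟩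
  obtain ⟨K, rfl⟩ : ∃ K, K' = K + 1 := ⟨K' - 1, by ring⟩
  have hK1 : 2 * M / ε + 1 ≤ K := by linarith
  have hK0 : 0 < K := lt_of_lt_of_le (by positivity) hK1
  have hYh : ∀ i, MemLp (fun ω => h (Y i ω)) (ENNReal.ofReal (2 * q)) P := fun i =>
    MemLp.of_bound (hh.comp_aemeasurable (hlaw i).aemeasurable).aestronglyMeasurable R
      (ae_of_all _ fun ω => hR _)
  have hYr : ∀ i, MemLp (fun ω => Y i ω - h (Y i ω)) (ENNReal.ofReal q) P := by
    intro i
    refine MemLp.sub ?_ ((hYh i).mono_exponent (ENNReal.ofReal_le_ofReal (by linarith)))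
    have := hmem
    rw [← (hlaw i).map_eq, memLp_map_measure_iff aestronglyMeasurable_id (hlaw i).aemeasurable]
      at this
    exact this
  have hIa := integral_abs_inv_sqrt_mul_sum_rpow_le (by linarith : 2 ≤ 2 * q)
    (hY.comp (fun _ => h) fun _ => hh) hYh
    (fun i => ((hlaw i).integral_comp hh.aestronglyMeasurable).trans hh0)
    (B := R ^ (2 * q)) (by positivity) (fun i => by
      calc _ ≤ ∫ ω, R ^ (2 * q) ∂P := by
            refine integral_mono_of_nonneg (ae_of_all _ fun _ => by positivity)
              (integrable_const _) (ae_of_all _ fun ω => ?_)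
            exact Real.rpow_le_rpow (abs_nonneg _) (hR _) (by linarith)
        _ = _ := by simp)
  have hIb := integral_abs_inv_sqrt_mul_sum_rpow_le hq
    (hY.comp (fun _ y => y - h y) fun _ => measurable_id.sub hh) hYr
    (fun i => ((hlaw i).integral_comp (f := fun y => y - h y)
      (measurable_id.sub hh).aestronglyMeasurable).trans (by
        rw [integral_sub hidi hhi, h0, hh0, sub_zero]))
    hδ0.le
    (fun i => ((hlaw i).integral_comp (f := fun y => |y - h y| ^ q)
      ((measurable_id.sub hh).abs.pow_const q).aestronglyMeasurable).le.trans hhδ)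
  simp only [Function.comp_apply] at hIa hIb
  set a : Ω → ℝ := fun ω => (√(n : ℝ))⁻¹ * ∑ i, h (Y i ω) with ha
  set b : Ω → ℝ := fun ω => (√(n : ℝ))⁻¹ * ∑ i, (Y i ω - h (Y i ω)) with hb
  have hab : ∀ ω, (√(n : ℝ))⁻¹ * ∑ i, Y i ω = a ω + b ω := by
    intro ω
    rw [ha, hb]; simp only
    rw [← mul_add, ← Finset.sum_add_distrib]; simp
  have hai : Integrable (fun ω => |a ω| ^ (2 * q)) P := by
    have : MemLp a (ENNReal.ofReal (2 * q)) P :=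
      (memLp_finsetSum Finset.univ fun i _ => hYh i).const_mul _
    exact (memLp_iff_integrable_abs_rpow (by linarith) this.1).1 this
  have hbi : Integrable (fun ω => |b ω| ^ q) P := by
    have : MemLp b (ENNReal.ofReal q) P :=
      (memLp_finsetSum Finset.univ fun i _ => hYr i).const_mul _
    exact (memLp_iff_integrable_abs_rpow (by linarith) this.1).1 this
  simp_rw [hab]
  calc _ ≤ ∫ ω, (2 ^ q * |b ω| ^ q + 4 ^ q * |a ω| ^ (2 * q) / K) ∂P := by
        refine integral_mono_of_nonneg (ae_of_all _ fun ω => sub_nonneg.2 (min_le_left _ _))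
          ((hbi.const_mul _).add ((hai.const_mul _).div_const _)) (ae_of_all _ fun ω => ?_)
        exact abs_rpow_sub_min_le hp hpq hK0 _ _
    _ = 2 ^ q * ∫ ω, |b ω| ^ q ∂P + 4 ^ q * (∫ ω, |a ω| ^ (2 * q) ∂P) / K := by
        rw [integral_add (hbi.const_mul _) ((hai.const_mul _).div_const _), integral_const_mul,
          integral_div, integral_const_mul]
    _ ≤ 2 ^ q * (2 * mzConst q * δ) + M / K := by
        rw [hM]; gcongr
    _ ≤ ε / 2 + ε / 2 := by
        refine add_le_add (le_of_eq ?_) ?_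
        · rw [hδ]; field_simp
        · rw [div_le_iff₀ hK0]
          have := mul_le_mul_of_nonneg_left hK1 hε.le
          rw [mul_add, mul_div_cancel₀ _ hε.ne'] at this
          linarith
    _ = ε := by ring

/-! ### Blocks of i.i.d. families -/

lemma pi_pi_map_uncurry {ι κ E : Type*} [Fintype ι] [Fintype κ] [MeasurableSpace E]
    (f : Measure E) [IsProbabilityMeasure f] :
    (Measure.pi fun _ : ι => Measure.pi fun _ : κ => f).map (fun w (p : ι × κ) => w p.1 p.2)
      = Measure.pi fun _ : ι × κ => f := by
  refine (Measure.pi_eq fun s hs => ?_).symm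
  rw [Measure.map_apply (by fun_prop) (.univ_pi hs)]
  have : (fun (w : ι → κ → E) (p : ι × κ) => w p.1 p.2) ⁻¹' (Set.univ.pi s)
      = Set.univ.pi fun i => Set.univ.pi fun k => s (i, k) := by
    ext w; simp
  rw [this, Measure.pi_pi]
  simp_rw [Measure.pi_pi]
  rw [Fintype.prod_prod_type]

/-- Functions of disjoint blocks of an i.i.d. family form an i.i.d. family. -/
lemma hasLaw_pi_map_of_iIndepFun {Ω ι κ E E' : Type*} [Fintype ι] [Fintype κ] [MeasurableSpace Ω]
    [MeasurableSpace E] [MeasurableSpace E'] {P : Measure Ω} {f : Measure E}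
    [IsProbabilityMeasure f] {X : ι × κ → Ω → E} (hX : iIndepFun X P)
    (hlaw : ∀ p, HasLaw (X p) f P) {F : (κ → E) → E'} (hF : Measurable F) :
    HasLaw (fun ω i => F fun k => X (i, k) ω)
      (Measure.pi fun _ : ι => (Measure.pi fun _ : κ => f).map F) P := by
  have hm : AEMeasurable (fun ω p => X p ω) P :=
    aemeasurable_pi_lambda _ fun p => (hlaw p).aemeasurable
  have h1 : P.map (fun ω p => X p ω) = Measure.pi fun _ : ι × κ => f := by
    rw [hX.map_fun_eq_pi_map fun p => (hlaw p).aemeasurable]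
    simp_rw [fun p => (hlaw p).map_eq]
  have hG : Measurable fun (w : ι × κ → E) (i : ι) => F fun k => w (i, k) :=
    measurable_pi_lambda _ fun i => hF.comp (measurable_pi_lambda _ fun k => measurable_pi_apply _)
  refine ⟨hG.comp_aemeasurable hm, ?_⟩
  have : IsProbabilityMeasure ((Measure.pi fun _ : κ => f).map F) :=
    Measure.isProbabilityMeasure_map hF.aemeasurable
  rw [← Measure.pi_map_pi fun _ => hF.aemeasurable]
  have h2 := AEMeasurable.map_map_of_aemeasurable (μ := P) (f := fun ω p => X p ω)
    hG.aemeasurable hm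
  have h3 : P.map (fun ω i => F fun k => X (i, k) ω)
      = (P.map (fun ω p => X p ω)).map (fun w i => F fun k => w (i, k)) := h2.symm
  rw [h3, h1, ← pi_pi_map_uncurry, Measure.map_map hG (by fun_prop)]
  rfl

lemma hasLaw_eval_of_hasLaw_pi {Ω ι E : Type*} [Fintype ι] [MeasurableSpace Ω]
    [MeasurableSpace E] {P : Measure Ω} {ν : Measure E} [IsProbabilityMeasure ν]
    {Y : Ω → ι → E} (h : HasLaw Y (Measure.pi fun _ : ι => ν) P) (i : ι) :
    HasLaw (fun ω => Y ω i) ν P :=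
  (measurePreserving_eval (fun _ : ι => ν) i).hasLaw.comp h

lemma iIndepFun_of_hasLaw_pi {Ω ι E : Type*} [Fintype ι] [MeasurableSpace Ω]
    [MeasurableSpace E] {P : Measure Ω} [IsProbabilityMeasure P] {ν : Measure E}
    [IsProbabilityMeasure ν] {Y : Ω → ι → E} (h : HasLaw Y (Measure.pi fun _ : ι => ν) P) :
    iIndepFun (fun i ω => Y ω i) P := by
  rw [iIndepFun_iff_map_fun_eq_pi_map fun i => (hasLaw_eval_of_hasLaw_pi h i).aemeasurable]
  simp_rw [fun i => (hasLaw_eval_of_hasLaw_pi h i).map_eq]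
  exact h.map_eq

/-! ### Planar central limit theorem -/

/-- The normalised sum of a family of vectors in the plane. -/
noncomputable def planarSum (n : ℕ) (W : Fin n → ℝ × ℝ) : WithLp 2 (ℝ × ℝ) :=
  WithLp.toLp 2 ((√(n : ℝ))⁻¹ * ∑ j, (W j).1, (√(n : ℝ))⁻¹ * ∑ j, (W j).2)

lemma measurable_planarSum (n : ℕ) : Measurable (planarSum n) := by
  unfold planarSum; fun_prop

/-- Cramér–Wold reduction: pairing with `u` gives a normalised sum of i.i.d. scalars. -/
lemma charFun_map_planarSum (ρ : Measure (ℝ × ℝ)) [IsProbabilityMeasure ρ] (n : ℕ)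
    (u : WithLp 2 (ℝ × ℝ)) :
    charFun ((Measure.pi fun _ : Fin n => ρ).map (planarSum n)) u
      = charFun (ρ.map fun z => z.1 * u.fst + z.2 * u.snd) ((√(n : ℝ))⁻¹ * 1) ^ n := by
  rw [charFun_apply, charFun_apply_real, integral_map (measurable_planarSum n).aemeasurable
    (by fun_prop), integral_map (by fun_prop) (by fun_prop)]
  have h := integral_fintype_prod_eq_pow (ι := Fin n) (μ := ρ)
    (fun z : ℝ × ℝ => Complex.exp (((√(n : ℝ))⁻¹ * 1 : ℝ) * (z.1 * u.fst + z.2 * u.snd : ℝ)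
      * Complex.I))
  rw [Fintype.card_fin] at h
  rw [← h]
  congr 1
  ext W
  rw [← Complex.exp_sum]
  congr 1
  rw [← Finset.sum_mul, ← Finset.mul_sum]
  congr 1
  rw [← Complex.ofReal_sum, ← Complex.ofReal_mul]
  congr 1
  simp only [planarSum, WithLp.prod_inner_apply, RCLike.inner_apply, conj_trivial,
    Finset.sum_add_distrib, ← Finset.sum_mul]
  simp
  ring

/-- The central limit theorem in the plane for uncorrelated coordinates of equal variance. -/
lemma tendsto_charFun_map_planarSum (ρ : Measure (ℝ × ℝ)) [IsProbabilityMeasure ρ]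
    (h1 : MemLp Prod.fst 2 ρ) (h2 : MemLp Prod.snd 2 ρ) (m1 : ∫ z, z.1 ∂ρ = 0)
    (m2 : ∫ z, z.2 ∂ρ = 0) {v : NNReal} (v1 : ∫ z, z.1 ^ 2 ∂ρ = v) (v2 : ∫ z, z.2 ^ 2 ∂ρ = v)
    (c : ∫ z, z.1 * z.2 ∂ρ = 0) (u : WithLp 2 (ℝ × ℝ)) :
    Tendsto (fun n : ℕ => charFun ((Measure.pi fun _ : Fin n => ρ).map (planarSum n)) u) atTop
      (𝓝 (charFun (((gaussianReal 0 v).prod (gaussianReal 0 v)).map (WithLp.toLp 2)) u)) := by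
  rw [charFun_prod, charFun_gaussianReal, charFun_gaussianReal, ← Complex.exp_add]
  simp_rw [charFun_map_planarSum]
  set s := u.fst
  set t := u.snd
  have hs : u.ofLp.1 = s := rfl
  have ht : u.ofLp.2 = t := rfl
  rw [hs, ht]
  set Z : ℝ × ℝ → ℝ := fun z => z.1 * s + z.2 * t with hZ
  have i1 : Integrable (fun z : ℝ × ℝ => z.1) ρ := h1.integrable (by norm_num)
  have i2 : Integrable (fun z : ℝ × ℝ => z.2) ρ := h2.integrable (by norm_num)
  have i11 : Integrable (fun z : ℝ × ℝ => z.1 ^ 2) ρ := h1.integrable_sq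
  have i22 : Integrable (fun z : ℝ × ℝ => z.2 ^ 2) ρ := h2.integrable_sq
  have i12 : Integrable (fun z : ℝ × ℝ => z.1 * z.2) ρ := h1.integrable_mul h2
  have hZ0 : ∫ z, Z z ∂ρ = 0 := by
    rw [hZ, integral_add (i1.mul_const s) (i2.mul_const t), integral_mul_const,
      integral_mul_const, m1, m2]; simp
  have hZ2 : ∫ z, Z z ^ 2 ∂ρ = v * (s ^ 2 + t ^ 2) := by
    have e : ∀ z, Z z ^ 2 = s ^ 2 * z.1 ^ 2 + 2 * s * t * (z.1 * z.2) + t ^ 2 * z.2 ^ 2 := by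
      intro z; simp only [hZ]; ring
    simp_rw [e]
    have j1 : Integrable (fun z : ℝ × ℝ => s ^ 2 * z.1 ^ 2) ρ := i11.const_mul _
    have j2 : Integrable (fun z : ℝ × ℝ => 2 * s * t * (z.1 * z.2)) ρ := i12.const_mul _
    have j3 : Integrable (fun z : ℝ × ℝ => s ^ 2 * z.1 ^ 2 + 2 * s * t * (z.1 * z.2)) ρ :=
      j1.add j2
    rw [integral_add j3 (i22.const_mul _), integral_add j1 j2, integral_const_mul,
      integral_const_mul, integral_const_mul, v1, v2, c]
    ring
  have hZm : Measurable Z := by fun_prop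
  set r2 : ℝ := v * (s ^ 2 + t ^ 2) with hr2
  have hr20 : 0 ≤ r2 := by positivity
  have hlim : (s * (0 : ℝ) * Complex.I - (v : ℝ) * s ^ 2 / 2
      + (t * (0 : ℝ) * Complex.I - (v : ℝ) * t ^ 2 / 2) : ℂ) = -((√r2 : ℝ) : ℂ) ^ 2 / 2 := by
    have e : ((√r2 : ℝ) : ℂ) ^ 2 = (r2 : ℂ) := by
      rw [← Complex.ofReal_pow, Real.sq_sqrt hr20]
    rw [e, hr2]
    push_cast; ring
  rw [hlim]
  -- The scalar theorem is for unit variance, so `Z` is divided by `√r2` and the limit evaluated at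
  -- `√r2`; if `r2 = 0`, then `Z` vanishes almost surely.
  rcases hr20.eq_or_lt with h0 | h0
  · have hZae : Z =ᵐ[ρ] fun _ => 0 := by
      rw [← h0] at hZ2
      have hi : Integrable (fun z => Z z ^ 2) ρ :=
        MemLp.integrable_sq ((h1.mul_const s).add (h2.mul_const t))
      have := (integral_eq_zero_iff_of_nonneg (fun z => sq_nonneg (Z z)) hi).1 hZ2
      filter_upwards [this] with z hz
      simpa using hz
    rw [Measure.map_congr hZae, ← h0]
    simp
  · have hr : 0 < √r2 := Real.sqrt_pos.2 h0
    have key := tendsto_charFun_inv_sqrt_mul_pow (P := ρ) (X := fun z => (√r2)⁻¹ * Z z)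
      (by fun_prop) (by rw [integral_const_mul, hZ0, mul_zero])
      (by
        have e : ((fun z => (√r2)⁻¹ * Z z) ^ 2) = fun z => ((√r2)⁻¹) ^ 2 * Z z ^ 2 := by
          ext z; simp [mul_pow]
        rw [e, integral_const_mul, hZ2, inv_pow, Real.sq_sqrt hr20, inv_mul_cancel₀ h0.ne'])
      (√r2)
    refine key.congr fun n => ?_
    rw [charFun_map_mul_comp hZm.aemeasurable]
    congr 2
    field_simp

/-- Asymptotic independence: the limit law is a product, so the limiting integral factors. It will
be used with `g` of Gaussian mean zero. -/
lemma tendsto_integral_mul_planarSum (ρ : Measure (ℝ × ℝ)) [IsProbabilityMeasure ρ]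
    (h1 : MemLp Prod.fst 2 ρ) (h2 : MemLp Prod.snd 2 ρ) (m1 : ∫ z, z.1 ∂ρ = 0)
    (m2 : ∫ z, z.2 ∂ρ = 0) {v : NNReal} (v1 : ∫ z, z.1 ^ 2 ∂ρ = v) (v2 : ∫ z, z.2 ^ 2 ∂ρ = v)
    (c : ∫ z, z.1 * z.2 ∂ρ = 0) {g : ℝ → ℝ} (hg : Continuous g) {R : ℝ} (hR : ∀ y, |g y| ≤ R) :
    Tendsto (fun n : ℕ => ∫ W, g ((√(n : ℝ))⁻¹ * ∑ j, (W j).1) * g ((√(n : ℝ))⁻¹ * ∑ j, (W j).2)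
      ∂(Measure.pi fun _ : Fin n => ρ)) atTop (𝓝 ((∫ y, g y ∂(gaussianReal 0 v)) ^ 2)) := by
  have hpm : ∀ n, IsProbabilityMeasure ((Measure.pi fun _ : Fin n => ρ).map (planarSum n)) :=
    fun n => Measure.isProbabilityMeasure_map (measurable_planarSum n).aemeasurable
  have hpm0 : IsProbabilityMeasure
      (((gaussianReal 0 v).prod (gaussianReal 0 v)).map (WithLp.toLp 2)) :=
    Measure.isProbabilityMeasure_map (by fun_prop)
  let μs : ℕ → ProbabilityMeasure (WithLp 2 (ℝ × ℝ)) := fun n => ⟨_, hpm n⟩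
  let μ₀ : ProbabilityMeasure (WithLp 2 (ℝ × ℝ)) := ⟨_, hpm0⟩
  have hconv : Tendsto μs atTop (𝓝 μ₀) := ProbabilityMeasure.tendsto_of_tendsto_charFun fun u =>
    tendsto_charFun_map_planarSum ρ h1 h2 m1 m2 v1 v2 c u
  have hR0 : 0 ≤ R := (abs_nonneg _).trans (hR 0)
  have hcont : Continuous fun z : WithLp 2 (ℝ × ℝ) => g z.fst * g z.snd := by fun_prop
  let φ : BoundedContinuousFunction (WithLp 2 (ℝ × ℝ)) ℝ :=
    BoundedContinuousFunction.ofNormedAddCommGroup (fun z => g z.fst * g z.snd) hcont (R * R)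
      fun z => by
        rw [Real.norm_eq_abs, abs_mul]
        exact mul_le_mul (hR _) (hR _) (abs_nonneg _) hR0
  have h := ProbabilityMeasure.tendsto_iff_forall_integral_tendsto.1 hconv φ
  have e0 : ∫ z, φ z ∂(((gaussianReal 0 v).prod (gaussianReal 0 v)).map (WithLp.toLp 2))
      = (∫ y, g y ∂(gaussianReal 0 v)) ^ 2 := by
    rw [integral_map (by fun_prop) φ.continuous.aestronglyMeasurable, sq, ← integral_prod_mul]
    rfl
  have en : ∀ n, ∫ z, φ z ∂((Measure.pi fun _ : Fin n => ρ).map (planarSum n))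
      = ∫ W, g ((√(n : ℝ))⁻¹ * ∑ j, (W j).1) * g ((√(n : ℝ))⁻¹ * ∑ j, (W j).2)
        ∂(Measure.pi fun _ : Fin n => ρ) := by
    intro n
    rw [integral_map (measurable_planarSum n).aemeasurable φ.continuous.aestronglyMeasurable]
    rfl
  rw [← e0]
  exact h.congr en

/-! ### Averages of weakly correlated variables -/

/-- Bound the first absolute moment by the second moment and expand the square: `m` diagonal terms
of size `R²`, the others at most `β`. No independence is needed. -/
lemma integral_abs_average_le {Ω : Type*} [MeasurableSpace Ω] {P : Measure Ω}
    [IsProbabilityMeasure P] {m : ℕ} {G : Fin m → Ω → ℝ} (hG : ∀ i, AEStronglyMeasurable (G i) P)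
    {R β : ℝ} (hR : ∀ i ω, |G i ω| ≤ R) (hβ0 : 0 ≤ β)
    (hβ : ∀ i i', i ≠ i' → ∫ ω, G i ω * G i' ω ∂P ≤ β) :
    ∫ ω, |(m : ℝ)⁻¹ * ∑ i, G i ω| ∂P ≤ √(R ^ 2 / m + β) := by
  have hmem : ∀ i, MemLp (G i) 2 P := fun i => MemLp.of_bound (hG i) R (ae_of_all _ (hR i))
  set S : Ω → ℝ := fun ω => (m : ℝ)⁻¹ * ∑ i, G i ω with hS
  have hSmem : MemLp S 2 P := (memLp_finsetSum Finset.univ fun i _ => hmem i).const_mul _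
  refine Real.le_sqrt_of_sq_le ?_
  have h1 : (∫ ω, |S ω| ∂P) ^ 2 ≤ ∫ ω, S ω ^ 2 ∂P := by
    have h := variance_nonneg |S| P
    rw [variance_eq_sub hSmem.abs] at h
    simpa using h
  refine h1.trans ?_
  have h2 : ∀ ω, S ω ^ 2 = ((m : ℝ)⁻¹) ^ 2 * ∑ i, ∑ i', G i ω * G i' ω := by
    intro ω
    rw [hS, ← Finset.sum_mul_sum]; ring
  have hij : ∀ i i', Integrable (fun ω => G i ω * G i' ω) P :=
    fun i i' => (hmem i).integrable_mul (hmem i')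
  simp_rw [h2]
  rw [integral_const_mul, integral_finsetSum _ fun i _ => integrable_finsetSum _ fun i' _ => hij i i']
  simp_rw [fun i => integral_finsetSum (μ := P) Finset.univ fun i' _ => hij i i']
  have h3 : ∀ i i', ∫ ω, G i ω * G i' ω ∂P ≤ (if i = i' then R ^ 2 else 0) + β := by
    intro i i'
    split_ifs with h
    · subst h
      have : ∫ ω, G i ω * G i ω ∂P ≤ ∫ ω, R ^ 2 ∂P := by
        refine integral_mono (hij i i) (integrable_const _) fun ω => ?_
        simp only
        rw [← sq, ← sq_abs]
        exact pow_le_pow_left₀ (abs_nonneg _) (hR i ω) 2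
      simp at this
      linarith
    · simpa using hβ i i' h
  rcases m.eq_zero_or_pos with rfl | hm
  · simpa using hβ0
  have hm0 : (0 : ℝ) < m := by exact_mod_cast hm
  calc _ ≤ ((m : ℝ)⁻¹) ^ 2 * ∑ i : Fin m, ∑ i' : Fin m, ((if i = i' then R ^ 2 else 0) + β) := by
        gcongr with i _ i' _; exact h3 i i'
    _ = _ := by
        simp [Finset.sum_add_distrib]
        field_simp

/-- Split `|T|^p - a` into the nonnegative excess over `K`, the truncation recentred at `c`, and the
bias `c - a`. -/
lemma integral_abs_average_sub_le {Ω : Type*} [MeasurableSpace Ω] {P : Measure Ω}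
    [IsProbabilityMeasure P] {p : ℝ} {m : ℕ} (hm : 0 < m) {T : Fin m → Ω → ℝ}
    (hT : ∀ i, AEMeasurable (T i) P) (hTi : ∀ i, Integrable (fun ω => |T i ω| ^ p) P)
    {K c a R β δ : ℝ} (hK : 0 ≤ K)
    (hR : ∀ y : ℝ, |min (|y| ^ p) K - c| ≤ R)
    (hδ : ∀ i, ∫ ω, (|T i ω| ^ p - min (|T i ω| ^ p) K) ∂P ≤ δ) (hβ0 : 0 ≤ β)
    (hβ : ∀ i i', i ≠ i' →
      ∫ ω, (min (|T i ω| ^ p) K - c) * (min (|T i' ω| ^ p) K - c) ∂P ≤ β) :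
    ∫ ω, |(m : ℝ)⁻¹ * ∑ i, |T i ω| ^ p - a| ∂P ≤ δ + √(R ^ 2 / m + β) + |c - a| := by
  have hm0 : (0 : ℝ) < m := by exact_mod_cast hm
  have hφ : Measurable fun y : ℝ => min (|y| ^ p) K :=
    (measurable_id.abs.pow_const p).min measurable_const
  have hmin : ∀ i, Integrable (fun ω => min (|T i ω| ^ p) K) P := fun i =>
    Integrable.of_bound (hφ.comp_aemeasurable (hT i)).aestronglyMeasurable K
      (ae_of_all _ fun ω => by
        rw [Real.norm_eq_abs, abs_of_nonneg (le_min (by positivity) hK)]; exact min_le_right _ _)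
  have hGm : ∀ i, AEStronglyMeasurable (fun ω => min (|T i ω| ^ p) K - c) P :=
    fun i => (hmin i).1.sub aestronglyMeasurable_const
  have h2 := integral_abs_average_le hGm (fun i ω => hR _) hβ0 hβ
  have i0 : ∀ i, Integrable (fun ω => |T i ω| ^ p - min (|T i ω| ^ p) K) P :=
    fun i => (hTi i).sub (hmin i)
  have i1 : Integrable (fun ω => (m : ℝ)⁻¹ * ∑ i, (|T i ω| ^ p - min (|T i ω| ^ p) K)) P :=
    (integrable_finsetSum _ fun i _ => i0 i).const_mul _
  have i2 : Integrable (fun ω => |(m : ℝ)⁻¹ * ∑ i, (min (|T i ω| ^ p) K - c)|) P :=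
    ((integrable_finsetSum _ fun i _ => (hmin i).sub (integrable_const c)).const_mul _).abs
  have i3 : Integrable (fun ω => (m : ℝ)⁻¹ * ∑ i, (|T i ω| ^ p - min (|T i ω| ^ p) K)
      + |(m : ℝ)⁻¹ * ∑ i, (min (|T i ω| ^ p) K - c)|) P := i1.add i2
  calc _ ≤ ∫ ω, ((m : ℝ)⁻¹ * ∑ i, (|T i ω| ^ p - min (|T i ω| ^ p) K)
        + |(m : ℝ)⁻¹ * ∑ i, (min (|T i ω| ^ p) K - c)| + |c - a|) ∂P := by
        refine integral_mono_of_nonneg (ae_of_all _ fun _ => abs_nonneg _)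
          (i3.add (integrable_const _)) (ae_of_all _ fun ω => ?_)
        simp only
        have h0 : 0 ≤ (m : ℝ)⁻¹ * ∑ i, (|T i ω| ^ p - min (|T i ω| ^ p) K) :=
          mul_nonneg (by positivity) (Finset.sum_nonneg fun i _ => sub_nonneg.2 (min_le_left _ _))
        have e : (m : ℝ)⁻¹ * ∑ i, |T i ω| ^ p - a
            = (m : ℝ)⁻¹ * ∑ i, (|T i ω| ^ p - min (|T i ω| ^ p) K)
              + (m : ℝ)⁻¹ * ∑ i, (min (|T i ω| ^ p) K - c) + (c - a) := by
          simp only [Finset.sum_sub_distrib, Finset.sum_const, Finset.card_univ, Fintype.card_fin,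
            nsmul_eq_mul]
          field_simp
          ring
        rw [e]
        refine (abs_add_le _ _).trans (add_le_add_left ((abs_add_le _ _).trans ?_) _)
        rw [abs_of_nonneg h0]
    _ = (m : ℝ)⁻¹ * ∑ i, ∫ ω, (|T i ω| ^ p - min (|T i ω| ^ p) K) ∂P
        + ∫ ω, |(m : ℝ)⁻¹ * ∑ i, (min (|T i ω| ^ p) K - c)| ∂P + |c - a| := by
        rw [integral_add i3 (integrable_const _), integral_add i1 i2, integral_const_mul,
          integral_finsetSum _ fun i _ => i0 i]
        simp
    _ ≤ (m : ℝ)⁻¹ * ∑ i : Fin m, δ + √(R ^ 2 / m + β) + |c - a| := by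
        gcongr with i _; exact hδ i
    _ = _ := by
        simp only [Finset.sum_const, Finset.card_univ, Fintype.card_fin, nsmul_eq_mul]
        field_simp

lemma tendsto_integral_min_natCast {α : Type*} [MeasurableSpace α] {μ : Measure α} {φ : α → ℝ}
    (hφ : Integrable φ μ) (h0 : ∀ y, 0 ≤ φ y) :
    Tendsto (fun K : ℕ => ∫ y, min (φ y) K ∂μ) atTop (𝓝 (∫ y, φ y ∂μ)) := by
  refine tendsto_integral_of_dominated_convergence φ (fun K => ?_) hφ (fun K => ae_of_all _ ?_)
    (ae_of_all _ ?_)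
  · exact (hφ.1.aemeasurable.min aemeasurable_const).aestronglyMeasurable
  · intro y
    rw [Real.norm_eq_abs, abs_of_nonneg (le_min (h0 y) (by positivity))]
    exact min_le_left _ _
  · intro y
    refine tendsto_const_nhds.congr' ?_
    filter_upwards [eventually_ge_atTop ⌈φ y⌉₊] with K hK
    rw [min_eq_left]
    exact (Nat.le_ceil _).trans (by exact_mod_cast hK)

/-! ### Laws of products of entries -/

/-- The law of the product of two independent variables with law `f`. -/
noncomputable def productLaw (f : Measure ℝ) : Measure ℝ :=
  (Measure.pi fun _ : Fin 2 => f).map fun w => w 0 * w 1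

/-- The law of `(a z, b z)` for independent variables `a`, `b`, `z` with law `f`. -/
noncomputable def pairProductLaw (f : Measure ℝ) : Measure (ℝ × ℝ) :=
  (Measure.pi fun _ : Fin 3 => f).map fun w => (w 0 * w 2, w 1 * w 2)

instance (f : Measure ℝ) [IsProbabilityMeasure f] : IsProbabilityMeasure (productLaw f) :=
  Measure.isProbabilityMeasure_map (by fun_prop)

instance (f : Measure ℝ) [IsProbabilityMeasure f] : IsProbabilityMeasure (pairProductLaw f) :=
  Measure.isProbabilityMeasure_map (by fun_prop)

/-- Independence makes `q` moments of each factor suffice; no `2q`-th moment is required. -/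
lemma memLp_mul_eval {ι : Type*} [Fintype ι] {f : Measure ℝ} [IsProbabilityMeasure f] {q : ℝ}
    (hq : 0 < q) (hf : MemLp id (ENNReal.ofReal q) f) {i j : ι} (hij : i ≠ j) :
    MemLp (fun w : ι → ℝ => w i * w j) (ENNReal.ofReal q) (Measure.pi fun _ => f) := by
  have hind : iIndepFun (fun (i : ι) (w : ι → ℝ) => |w i| ^ q) (Measure.pi fun _ => f) :=
    iIndepFun_pi (X := fun _ (y : ℝ) => |y| ^ q)
      fun _ => (measurable_id.abs.pow_const q).aemeasurable
  have hint : ∀ i : ι, Integrable (fun w : ι → ℝ => |w i| ^ q) (Measure.pi fun _ => f) := fun i =>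
    (measurePreserving_eval (fun _ : ι => f) i).integrable_comp_of_integrable
      ((memLp_iff_integrable_abs_rpow hq hf.1).1 hf)
  rw [memLp_iff_integrable_abs_rpow hq (by fun_prop)]
  have h := (hind.indepFun hij).integrable_mul (hint i) (hint j)
  refine h.congr (ae_of_all _ fun w => ?_)
  simp only [Pi.mul_apply]
  rw [abs_mul, Real.mul_rpow (abs_nonneg _) (abs_nonneg _)]

lemma memLp_id_productLaw {f : Measure ℝ} [IsProbabilityMeasure f] {q : ℝ}
    (hq : 0 < q) (hf : MemLp id (ENNReal.ofReal q) f) :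
    MemLp id (ENNReal.ofReal q) (productLaw f) := by
  rw [productLaw, memLp_map_measure_iff aestronglyMeasurable_id (by fun_prop)]
  exact memLp_mul_eval hq hf (by decide)

lemma integral_id_productLaw {f : Measure ℝ} [IsProbabilityMeasure f] (h0 : ∫ y, y ∂f = 0) :
    ∫ y, y ∂(productLaw f) = 0 := by
  rw [productLaw, integral_map (by fun_prop) (by fun_prop)]
  have h := integral_fintype_prod_eq_prod (μ := fun _ : Fin 2 => f) fun _ (y : ℝ) => y
  simp only [Fin.prod_univ_two, h0] at h
  rw [h, zero_mul]

lemma memLp_fst_pairProductLaw {f : Measure ℝ} [IsProbabilityMeasure f] (hf : MemLp id 2 f) :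
    MemLp Prod.fst 2 (pairProductLaw f) := by
  rw [pairProductLaw, memLp_map_measure_iff (by fun_prop) (by fun_prop)]
  have := memLp_mul_eval (ι := Fin 3) (i := 0) (j := 2) (by norm_num : (0 : ℝ) < 2)
    (by simpa using hf) (by decide)
  rw [ENNReal.ofReal_ofNat] at this
  exact this

lemma memLp_snd_pairProductLaw {f : Measure ℝ} [IsProbabilityMeasure f] (hf : MemLp id 2 f) :
    MemLp Prod.snd 2 (pairProductLaw f) := by
  rw [pairProductLaw, memLp_map_measure_iff (by fun_prop) (by fun_prop)]
  have := memLp_mul_eval (ι := Fin 3) (i := 1) (j := 2) (by norm_num : (0 : ℝ) < 2)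
    (by simpa using hf) (by decide)
  rw [ENNReal.ofReal_ofNat] at this
  exact this

/-- With small exponents this yields every mean, variance and covariance that the planar theorem
asks for. -/
lemma integral_pairProductLaw {f : Measure ℝ} [IsProbabilityMeasure f] (k l : ℕ) :
    ∫ z, z.1 ^ k * z.2 ^ l ∂(pairProductLaw f)
      = (∫ y, y ^ k ∂f) * (∫ y, y ^ l ∂f) * ∫ y, y ^ (k + l) ∂f := by
  rw [pairProductLaw, integral_map (by fun_prop) (by fun_prop)]
  have h := integral_fintype_prod_eq_prod (μ := fun _ : Fin 3 => f)
    fun i (y : ℝ) => y ^ (![k, l, k + l] i)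
  simp only [Fin.prod_univ_three, Matrix.cons_val_zero, Matrix.cons_val_one,
    Matrix.cons_val_two, Matrix.head_cons, Matrix.tail_cons] at h
  rw [← h]
  congr 1
  ext w
  ring

/-! ### Joint laws of rows -/

namespace IIDEntries

variable {Ω : Type u} [MeasurableSpace Ω] {P : Measure Ω} {f : Measure ℝ} {m n : ℕ}
  {A : Ω → Matrix (Fin m) (Fin n) ℝ} {x : Ω → Fin n → ℝ}

lemma hasLaw_sumElim (h : IIDEntries P f A x) (s : Fin m × Fin n ⊕ Fin n) :
    HasLaw (Sum.elim (fun (ij : Fin m × Fin n) (ω : Ω) => A ω ij.1 ij.2)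
      (fun (j : Fin n) (ω : Ω) => x ω j) s) f P := by
  cases s with
  | inl ij => exact h.law_matrix _ _
  | inr j => exact h.law_vector _

lemma hasLaw_row [IsProbabilityMeasure f] (h : IIDEntries P f A x) (i : Fin m) :
    HasLaw (fun ω j => A ω i j * x ω j) (Measure.pi fun _ : Fin n => productLaw f) P := by
  let g : Fin n × Fin 2 → Fin m × Fin n ⊕ Fin n := fun p => ![Sum.inl (i, p.1), Sum.inr p.1] p.2
  have hg : g.Injective := by
    rintro ⟨j, k⟩ ⟨j', k'⟩ hjk
    fin_cases k <;> fin_cases k' <;> simp_all [g]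
  have hX := h.indep.precomp hg
  exact hasLaw_pi_map_of_iIndepFun hX (fun p => h.hasLaw_sumElim (g p))
    (F := fun w => w 0 * w 1) (by fun_prop)

/-- The two rows share `x`, but across the column index `j` the triples `(A_ij, A_i'j, x_j)` are
disjoint blocks, hence i.i.d. -/
lemma hasLaw_row_pair [IsProbabilityMeasure f] (h : IIDEntries P f A x) {i i' : Fin m}
    (hi : i ≠ i') :
    HasLaw (fun ω j => (A ω i j * x ω j, A ω i' j * x ω j))
      (Measure.pi fun _ : Fin n => pairProductLaw f) P := by
  let g : Fin n × Fin 3 → Fin m × Fin n ⊕ Fin n :=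
    fun p => ![Sum.inl (i, p.1), Sum.inl (i', p.1), Sum.inr p.1] p.2
  have hg : g.Injective := by
    rintro ⟨j, k⟩ ⟨j', k'⟩ hjk
    fin_cases k <;> fin_cases k' <;> simp_all [g]
  have hX := h.indep.precomp hg
  exact hasLaw_pi_map_of_iIndepFun hX (fun p => h.hasLaw_sumElim (g p))
    (F := fun w => (w 0 * w 2, w 1 * w 2)) (by fun_prop)

lemma aemeasurable_row_sum [IsProbabilityMeasure f] (h : IIDEntries P f A x) (i : Fin m) :
    AEMeasurable (fun ω => (√(n : ℝ))⁻¹ * ∑ j, A ω i j * x ω j) P :=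
  (Finset.aemeasurable_fun_sum _ fun j _ =>
    (hasLaw_eval_of_hasLaw_pi (h.hasLaw_row i) j).aemeasurable).const_mul _

end IIDEntries

lemma IIDEntries.integrable_row_sum {Ω : Type u} [MeasurableSpace Ω] {P : Measure Ω}
    {f : Measure ℝ} {m n : ℕ} {A : Ω → Matrix (Fin m) (Fin n) ℝ} {x : Ω → Fin n → ℝ}
    [IsProbabilityMeasure f] (h : IIDEntries P f A x) {p : ℝ} (hp : 0 < p)
    (hf : MemLp id (ENNReal.ofReal p) f) (i : Fin m) :
    Integrable (fun ω => |(√(n : ℝ))⁻¹ * ∑ j, A ω i j * x ω j| ^ p) P := by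
  have hmem : ∀ j, MemLp (fun ω => A ω i j * x ω j) (ENNReal.ofReal p) P := by
    intro j
    have hj := hasLaw_eval_of_hasLaw_pi (h.hasLaw_row i) j
    have hν := memLp_id_productLaw hp hf
    rw [← hj.map_eq, memLp_map_measure_iff aestronglyMeasurable_id hj.aemeasurable] at hν
    exact hν
  have hsum : MemLp (fun ω => ∑ j, A ω i j * x ω j) (ENNReal.ofReal p) P :=
    memLp_finsetSum Finset.univ fun j _ => hmem j
  exact (memLp_iff_integrable_abs_rpow hp (h.aemeasurable_row_sum i).aestronglyMeasurable).1
    (hsum.const_mul _)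

/-! ### The denominator -/

lemma exists_exponent {f : Measure ℝ} {p : ℝ} (hf_sq : MemLp id 2 f)
    (hf_p : MemLp id (ENNReal.ofReal p) f) :
    ∃ q, p ≤ q ∧ 2 ≤ q ∧ MemLp id (ENNReal.ofReal q) f := by
  rcases le_total p 2 with h | h
  · exact ⟨2, h, le_rfl, by simpa using hf_sq⟩
  · exact ⟨p, le_rfl, h, hf_p⟩

/-- The average of `|(Ax)_i / √n|^p` converges in mean to the Gaussian absolute moment. -/
lemma tendsto_integral_abs_average_rows {f : Measure ℝ} [IsProbabilityMeasure f] {p : ℝ}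
    (hp : 1 ≤ p) (hf_sq : MemLp id 2 f) (hf_p : MemLp id (ENNReal.ofReal p) f)
    (hf_mean : ∫ y, y ∂f = 0) {Ω : Type u} [MeasurableSpace Ω] {P : Measure Ω}
    [IsProbabilityMeasure P] {A : ∀ m n : ℕ, Ω → Matrix (Fin m) (Fin n) ℝ}
    {x : ∀ m n : ℕ, Ω → Fin n → ℝ} (hAx : ∀ m n : ℕ, IIDEntries P f (A m n) (x m n)) :
    Tendsto (fun mn : ℕ × ℕ => ∫ ω, |(mn.1 : ℝ)⁻¹ * ∑ i : Fin mn.1,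
        |(√(mn.2 : ℝ))⁻¹ * ∑ j, A mn.1 mn.2 ω i j * x mn.1 mn.2 ω j| ^ p
        - gaussAbsMoment f p| ∂P) (atTop ×ˢ atTop) (𝓝 0) := by
  have hp0 : 0 < p := by linarith
  obtain ⟨q, hpq, hq, hf_q⟩ := exists_exponent hf_sq hf_p
  set v : NNReal := (Var[id; f] ^ 2).toNNReal with hv
  set a := gaussAbsMoment f p with ha
  have ha' : a = ∫ y, |y| ^ p ∂(gaussianReal 0 v) := rfl
  have hGi : Integrable (fun y : ℝ => |y| ^ p) (gaussianReal 0 v) :=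
    (memLp_iff_integrable_abs_rpow hp0 aestronglyMeasurable_id).1
      (memLp_id_gaussianReal' _ (by simp))
  have hsq : ∫ y, y ^ 2 ∂f = Var[id; f] := by
    rw [variance_of_integral_eq_zero aemeasurable_id hf_mean]; rfl
  have hv' : (v : ℝ) = Var[id; f] * Var[id; f] := by
    rw [hv, Real.coe_toNNReal _ (sq_nonneg _), sq]
  rw [Metric.tendsto_nhds]
  intro ε hε
  obtain ⟨K₀, hK₀⟩ := exists_integral_abs_rpow_sub_min_le.{u} hp0.le hpq hq
    (memLp_id_productLaw (by linarith) hf_q) (integral_id_productLaw hf_mean)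
    (by positivity : 0 < ε / 4)
  -- `K` is fixed before `m` and `n`, making both the excess of the rows and the Gaussian bias at
  -- most `ε/4`.
  obtain ⟨K, hKa, hKK⟩ : ∃ K : ℕ,
      |∫ y, min (|y| ^ p) K ∂(gaussianReal 0 v) - a| < ε / 4 ∧ K₀ ≤ K := by
    have h1 := (Metric.tendsto_nhds.1 (tendsto_integral_min_natCast hGi fun y => by positivity)
      (ε / 4) (by positivity)).and (tendsto_natCast_atTop_atTop.eventually_ge_atTop K₀)
    obtain ⟨K, hK⟩ := h1.exists
    exact ⟨K, by rw [ha']; simpa only [Real.dist_eq] using hK.1, hK.2⟩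
  set c := ∫ y, min (|y| ^ p) (K : ℝ) ∂(gaussianReal 0 v) with hc
  set g : ℝ → ℝ := fun y => min (|y| ^ p) K - c with hg
  have hgc : Continuous g :=
    ((continuous_abs.rpow_const fun _ => Or.inr hp0.le).min continuous_const).sub continuous_const
  have hgR : ∀ y, |g y| ≤ K + |c| := by
    intro y
    refine (abs_sub _ _).trans (add_le_add_left ?_ _)
    rw [abs_of_nonneg (le_min (by positivity) (by positivity))]
    exact min_le_right _ _
  have hg0 : ∫ y, g y ∂(gaussianReal 0 v) = 0 := by
    rw [hg, integral_sub _ (integrable_const c)]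
    · simp [← hc]
    · exact (hGi.inf (integrable_const (K : ℝ)))
  have hβ := tendsto_integral_mul_planarSum (pairProductLaw f) (v := v)
    (memLp_fst_pairProductLaw hf_sq) (memLp_snd_pairProductLaw hf_sq)
    (by simpa [hf_mean] using integral_pairProductLaw (f := f) 1 0)
    (by simpa [hf_mean] using integral_pairProductLaw (f := f) 0 1)
    (by simpa [hsq, hv'] using integral_pairProductLaw (f := f) 2 0)
    (by simpa [hsq, hv'] using integral_pairProductLaw (f := f) 0 2)
    (by simpa [hf_mean] using integral_pairProductLaw (f := f) 1 1) hgc hgR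
  rw [hg0, zero_pow two_ne_zero] at hβ
  -- Diagonal and off-diagonal terms get `η` each, so the square root is at most `ε/4`. The first
  -- condition restricts only `m`, the second only `n`, so the limit is joint.
  set η : ℝ := (ε / 4) ^ 2 / 2 with hη
  have hη0 : 0 < η := by positivity
  have hn : ∀ᶠ n : ℕ in atTop, ∫ W, g ((√(n : ℝ))⁻¹ * ∑ j, (W j).1)
      * g ((√(n : ℝ))⁻¹ * ∑ j, (W j).2) ∂(Measure.pi fun _ : Fin n => pairProductLaw f) < η :=
    hβ.eventually_lt_const hη0
  have hm : ∀ᶠ k : ℕ in atTop, ((K : ℝ) + |c|) ^ 2 / k < η :=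
    (tendsto_const_div_atTop_nhds_zero_nat _).eventually_lt_const hη0
  filter_upwards [(hm.and (eventually_gt_atTop 0)).prod_mk hn] with ⟨m, n⟩
    ⟨⟨hm, hm0⟩, hn⟩
  simp only at hm hm0 hn ⊢
  have hrow := fun i => (hAx m n).hasLaw_row i
  have hentry := fun i j => hasLaw_eval_of_hasLaw_pi (hrow i) j
  have hT := fun i => (hAx m n).aemeasurable_row_sum i
  have hTi := fun i => (hAx m n).integrable_row_sum hp0 hf_p i
  have hpair : ∀ i i', i ≠ i' → ∫ ω, g ((√(n : ℝ))⁻¹ * ∑ j, A m n ω i j * x m n ω j)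
      * g ((√(n : ℝ))⁻¹ * ∑ j, A m n ω i' j * x m n ω j) ∂P
      = ∫ W, g ((√(n : ℝ))⁻¹ * ∑ j, (W j).1) * g ((√(n : ℝ))⁻¹ * ∑ j, (W j).2)
        ∂(Measure.pi fun _ : Fin n => pairProductLaw f) := by
    intro i i' hii
    have hgm : AEStronglyMeasurable (fun W : Fin n → ℝ × ℝ =>
        g ((√(n : ℝ))⁻¹ * ∑ j, (W j).1) * g ((√(n : ℝ))⁻¹ * ∑ j, (W j).2))
        (Measure.pi fun _ : Fin n => pairProductLaw f) := by
      have : Continuous (fun W : Fin n → ℝ × ℝ =>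
        g ((√(n : ℝ))⁻¹ * ∑ j, (W j).1) * g ((√(n : ℝ))⁻¹ * ∑ j, (W j).2)) := by fun_prop
      exact this.aestronglyMeasurable
    exact ((hAx m n).hasLaw_row_pair hii).integral_comp hgm
  have hle := integral_abs_average_sub_le hm0 hT hTi (a := a) (by positivity : (0 : ℝ) ≤ K) hgR
    (δ := ε / 4) (fun i => hK₀ K hKK (iIndepFun_of_hasLaw_pi (hrow i)) (hentry i)) hη0.le
    (fun i i' hii => (hpair i i' hii).le.trans hn.le)
  have hsqrt : √(((K : ℝ) + |c|) ^ 2 / m + η) ≤ ε / 4 := by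
    rw [Real.sqrt_le_left (by positivity)]
    linarith
  rw [Real.dist_eq, sub_zero, abs_of_nonneg (integral_nonneg fun _ => abs_nonneg _)]
  linarith

/-! ### The numerator -/

lemma hasLaw_pi_of_iIndepFun {Ω ι E : Type*} [Fintype ι] [MeasurableSpace Ω] [MeasurableSpace E]
    {P : Measure Ω} {f : Measure E} {X : ι → Ω → E} (hX : iIndepFun X P)
    (hlaw : ∀ i, HasLaw (X i) f P) : HasLaw (fun ω i => X i ω) (Measure.pi fun _ : ι => f) P where
  aemeasurable := aemeasurable_pi_lambda _ fun i => (hlaw i).aemeasurable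
  map_eq := by
    rw [hX.map_fun_eq_pi_map fun i => (hlaw i).aemeasurable]
    simp_rw [fun i => (hlaw i).map_eq]

/-- The mean absolute deviation of an empirical average from its expectation. -/
noncomputable def averageDeviation (f : Measure ℝ) (φ : ℝ → ℝ) (m : ℕ) : ℝ :=
  ∫ w, |(m : ℝ)⁻¹ * ∑ i, φ (w i) - ∫ y, φ y ∂f| ∂(Measure.pi fun _ : Fin m => f)

/-- Arrays of different sizes need not be related on `Ω`, so the strong law cannot be applied to
them directly. The deviation depends only on the law of `m` samples and is computed on an infinite
product space. -/
lemma tendsto_averageDeviation {f : Measure ℝ} [IsProbabilityMeasure f] {φ : ℝ → ℝ}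
    (hφm : Measurable φ) (hφ : Integrable φ f) :
    Tendsto (averageDeviation f φ) atTop (𝓝 0) := by
  set Q := Measure.infinitePi fun _ : ℕ => f with hQ
  have hid : iIndepFun (fun (i : ℕ) (ω : ℕ → ℝ) => ω i) Q :=
    iIndepFun_infinitePi (X := fun _ (y : ℝ) => y) fun _ => measurable_id
  have hlaw : ∀ i : ℕ, HasLaw (fun ω : ℕ → ℝ => ω i) f Q := fun i =>
    (measurePreserving_eval_infinitePi (fun _ : ℕ => f) i).hasLaw
  have hmp := fun i : ℕ => measurePreserving_eval_infinitePi (fun _ : ℕ => f) i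
  have hint : Integrable (fun ω : ℕ → ℝ => φ (ω 0)) Q :=
    (hmp 0).integrable_comp_of_integrable hφ
  have hindep := hid.comp (fun _ => φ) fun _ => hφm
  have hident : ∀ i : ℕ, IdentDistrib (fun ω : ℕ → ℝ => φ (ω i)) (fun ω => φ (ω 0)) Q Q := fun i =>
    IdentDistrib.comp ⟨(hmp i).measurable.aemeasurable, (hmp 0).measurable.aemeasurable,
      (hmp i).map_eq.trans (hmp 0).map_eq.symm⟩ hφm
  have h := strong_law_Lp le_rfl (by simp) (fun (i : ℕ) (ω : ℕ → ℝ) => φ (ω i))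
    (memLp_one_iff_integrable.2 hint) (fun i j hij => hindep.indepFun hij) hident
  have hmean : ∫ ω, φ (ω 0) ∂Q = ∫ y, φ y ∂f :=
    (hlaw 0).integral_comp hφm.aestronglyMeasurable
  have h2 := (ENNReal.tendsto_toReal (by simp)).comp h
  rw [ENNReal.toReal_zero] at h2
  refine h2.congr fun m => ?_
  have hm := (hasLaw_pi_of_iIndepFun (hid.precomp (g := fun i : Fin m => (i : ℕ))
    Fin.val_injective) fun i => hlaw i).integral_comp
    (f := fun w : Fin m → ℝ => |(m : ℝ)⁻¹ * ∑ i, φ (w i) - ∫ y, φ y ∂f|)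
    (Measurable.aestronglyMeasurable (by fun_prop))
  rw [averageDeviation, ← hm, Function.comp_apply, eLpNorm_one_eq_lintegral_enorm,
    ← integral_norm_eq_lintegral_enorm]
  · refine integral_congr_ae (ae_of_all _ fun ω => ?_)
    simp only [hmean, Function.comp_apply, Real.norm_eq_abs, smul_eq_mul,
      Finset.sum_range]
  · exact Measurable.aestronglyMeasurable (by fun_prop)

namespace IIDEntries

variable {Ω : Type u} [MeasurableSpace Ω] {P : Measure Ω} {f : Measure ℝ} {m n : ℕ}
  {A : Ω → Matrix (Fin m) (Fin n) ℝ} {x : Ω → Fin n → ℝ}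

lemma hasLaw_column (h : IIDEntries P f A x) (j : Fin n) :
    HasLaw (fun ω i => A ω i j) (Measure.pi fun _ : Fin m => f) P := by
  have hg : (fun i : Fin m => (Sum.inl (i, j) : Fin m × Fin n ⊕ Fin n)).Injective := by
    intro i i' hi; simpa using hi
  exact hasLaw_pi_of_iIndepFun (h.indep.precomp hg) fun i => h.law_matrix i j

lemma hasLaw_vector (h : IIDEntries P f A x) :
    HasLaw x (Measure.pi fun _ : Fin n => f) P :=
  hasLaw_pi_of_iIndepFun (h.indep.precomp (g := fun j : Fin n => (Sum.inr j :
    Fin m × Fin n ⊕ Fin n)) Sum.inr_injective) h.law_vector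

lemma indepFun_vector_column (h : IIDEntries P f A x) (j : Fin n) :
    IndepFun (fun ω => x ω j) (fun ω i => A ω i j) P := by
  classical
  let S : Finset (Fin m × Fin n ⊕ Fin n) := {Sum.inr j}
  let T : Finset (Fin m × Fin n ⊕ Fin n) := Finset.univ.image fun i : Fin m => Sum.inl (i, j)
  have hST : Disjoint S T := by simp [S, T]
  have hind := h.indep.indepFun_finset₀ S T hST fun s => (h.hasLaw_sumElim s).aemeasurable
  exact hind.comp (φ := fun w : S → ℝ => w ⟨Sum.inr j, by simp [S]⟩)
    (ψ := fun (w : T → ℝ) (i : Fin m) => w ⟨Sum.inl (i, j), by simp [T]⟩)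
    (by fun_prop) (by fun_prop)

/-- Averages of `φ (x_j) φ (A_ij)` are close in mean to the squared expectation of `φ`. -/
lemma integral_abs_numerator_sub_le [IsProbabilityMeasure f] (h : IIDEntries P f A x)
    {φ : ℝ → ℝ} (hφm : Measurable φ) (hφ : Integrable φ f) (h0 : ∀ y, 0 ≤ φ y) (hn : 0 < n) :
    Integrable (fun ω => (n : ℝ)⁻¹ * ∑ j, φ (x ω j) * ((m : ℝ)⁻¹ * ∑ i, φ (A ω i j))) P ∧
    ∫ ω, |(n : ℝ)⁻¹ * ∑ j, φ (x ω j) * ((m : ℝ)⁻¹ * ∑ i, φ (A ω i j)) - (∫ y, φ y ∂f) ^ 2| ∂P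
      ≤ (∫ y, φ y ∂f) * averageDeviation f φ m + (∫ y, φ y ∂f) * averageDeviation f φ n := by
  have hP : IsProbabilityMeasure P := (h.law_vector ⟨0, hn⟩).isProbabilityMeasure
  set μ := ∫ y, φ y ∂f with hμ
  have hμ0 : 0 ≤ μ := integral_nonneg h0
  have hn0 : (0 : ℝ) < n := by exact_mod_cast hn
  have hint : ∀ {Y : Ω → ℝ}, HasLaw Y f P → Integrable (fun ω => φ (Y ω)) P := by
    intro Y hY
    have := hφ
    rw [← hY.map_eq, integrable_map_measure (by rw [hY.map_eq]; exact hφ.1) hY.aemeasurable] at this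
    exact this
  have hxi : ∀ j, Integrable (fun ω => φ (x ω j)) P := fun j => hint (h.law_vector j)
  have hci : ∀ j, Integrable (fun ω => (m : ℝ)⁻¹ * ∑ i, φ (A ω i j)) P := fun j =>
    (integrable_finsetSum _ fun i _ => hint (h.law_matrix i j)).const_mul _
  have hdi : ∀ j, Integrable (fun ω => |(m : ℝ)⁻¹ * ∑ i, φ (A ω i j) - μ|) P := fun j =>
    ((hci j).sub (integrable_const μ)).abs
  have hind1 : ∀ j, IndepFun (fun ω => φ (x ω j)) (fun ω => (m : ℝ)⁻¹ * ∑ i, φ (A ω i j)) P :=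
    fun j => (h.indepFun_vector_column j).comp (φ := φ)
      (ψ := fun w : Fin m → ℝ => (m : ℝ)⁻¹ * ∑ i, φ (w i)) hφm (by fun_prop)
  have hind2 : ∀ j, IndepFun (fun ω => φ (x ω j))
      (fun ω => |(m : ℝ)⁻¹ * ∑ i, φ (A ω i j) - μ|) P :=
    fun j => (h.indepFun_vector_column j).comp (φ := φ)
      (ψ := fun w : Fin m → ℝ => |(m : ℝ)⁻¹ * ∑ i, φ (w i) - μ|) hφm (by fun_prop)
  have hp1 : ∀ j, Integrable (fun ω => φ (x ω j) * ((m : ℝ)⁻¹ * ∑ i, φ (A ω i j))) P :=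
    fun j => (hind1 j).integrable_mul (hxi j) (hci j)
  have hp2 : ∀ j, Integrable (fun ω => φ (x ω j) * |(m : ℝ)⁻¹ * ∑ i, φ (A ω i j) - μ|) P :=
    fun j => (hind2 j).integrable_mul (hxi j) (hdi j)
  have hI2 : ∀ j, ∫ ω, φ (x ω j) * |(m : ℝ)⁻¹ * ∑ i, φ (A ω i j) - μ| ∂P
      = μ * averageDeviation f φ m := by
    intro j
    rw [(hind2 j).integral_fun_mul_eq_mul_integral (hxi j).1 (hdi j).1]
    congr 1
    · exact (h.law_vector j).integral_comp hφm.aestronglyMeasurable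
    · exact (h.hasLaw_column j).integral_comp
        (f := fun w : Fin m → ℝ => |(m : ℝ)⁻¹ * ∑ i, φ (w i) - μ|)
        (Measurable.aestronglyMeasurable (by fun_prop))
  have hI3 : ∫ ω, |(n : ℝ)⁻¹ * ∑ j, φ (x ω j) - μ| ∂P = averageDeviation f φ n :=
    h.hasLaw_vector.integral_comp (f := fun w : Fin n → ℝ => |(n : ℝ)⁻¹ * ∑ i, φ (w i) - μ|)
      (Measurable.aestronglyMeasurable (by fun_prop))
  refine ⟨(integrable_finsetSum _ fun j _ => hp1 j).const_mul _, ?_⟩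
  have i1 : Integrable (fun ω => (n : ℝ)⁻¹ * ∑ j, φ (x ω j)
      * |(m : ℝ)⁻¹ * ∑ i, φ (A ω i j) - μ|) P :=
    (integrable_finsetSum _ fun j _ => hp2 j).const_mul _
  have i0 : Integrable (fun ω => (n : ℝ)⁻¹ * ∑ j, φ (x ω j)) P :=
    (integrable_finsetSum _ fun j _ => hxi j).const_mul _
  have i2 : Integrable (fun ω => μ * |(n : ℝ)⁻¹ * ∑ j, φ (x ω j) - μ|) P :=
    ((i0.sub (integrable_const μ)).abs).const_mul _
  calc _ ≤ ∫ ω, ((n : ℝ)⁻¹ * ∑ j, φ (x ω j) * |(m : ℝ)⁻¹ * ∑ i, φ (A ω i j) - μ|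
        + μ * |(n : ℝ)⁻¹ * ∑ j, φ (x ω j) - μ|) ∂P := by
        refine integral_mono_of_nonneg (ae_of_all _ fun _ => abs_nonneg _) (i1.add i2)
          (ae_of_all _ fun ω => ?_)
        simp only
        -- Replace each column average by `μ`, then average over `x`. The first error factors in
        -- expectation because `x_j` is independent of column `j`.
        have e : (n : ℝ)⁻¹ * ∑ j, φ (x ω j) * ((m : ℝ)⁻¹ * ∑ i, φ (A ω i j)) - μ ^ 2
            = (n : ℝ)⁻¹ * ∑ j, φ (x ω j) * ((m : ℝ)⁻¹ * ∑ i, φ (A ω i j) - μ)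
              + μ * ((n : ℝ)⁻¹ * ∑ j, φ (x ω j) - μ) := by
          simp only [mul_sub, Finset.sum_sub_distrib, ← Finset.sum_mul]
          ring
        rw [e]
        refine (abs_add_le _ _).trans (add_le_add ?_ ?_)
        · rw [abs_mul, abs_of_nonneg (by positivity : 0 ≤ (n : ℝ)⁻¹)]
          gcongr
          refine (Finset.abs_sum_le_sum_abs _ _).trans (Finset.sum_le_sum fun j _ => ?_)
          rw [abs_mul, abs_of_nonneg (h0 _)]
        · rw [abs_mul, abs_of_nonneg hμ0]
    _ = _ := by
        rw [integral_add i1 i2, integral_const_mul, integral_const_mul,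
          integral_finsetSum _ fun j _ => hp2 j, hI3]
        simp_rw [hI2]
        simp only [Finset.sum_const, Finset.card_univ, Fintype.card_fin, nsmul_eq_mul]
        field_simp

end IIDEntries

/-! ### Convergence in probability of the quotient -/

lemma tendstoInMeasure_of_tendsto_integral_abs {Ω ι : Type*} [MeasurableSpace Ω] {P : Measure Ω}
    [IsFiniteMeasure P] {l : Filter ι} {X : ι → Ω → ℝ} {a : ℝ}
    (hX : ∀ᶠ i in l, Integrable (X i) P)
    (h : Tendsto (fun i => ∫ ω, |X i ω - a| ∂P) l (𝓝 0)) :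
    TendstoInMeasure P X l fun _ => a := by
  rw [tendstoInMeasure_iff_measureReal_dist]
  intro ε hε
  have h1 : Tendsto (fun i => ε⁻¹ * ∫ ω, |X i ω - a| ∂P) l (𝓝 0) := by
    simpa using h.const_mul ε⁻¹
  refine squeeze_zero' (Eventually.of_forall fun i => measureReal_nonneg) ?_ h1
  filter_upwards [hX] with i hi
  have := mul_meas_ge_le_integral_of_nonneg (ae_of_all P fun ω => abs_nonneg (X i ω - a))
    (hi.sub (integrable_const a)).abs ε
  rw [← div_eq_inv_mul, le_div_iff₀ hε, mul_comm]
  simpa only [Real.dist_eq] using this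

/-- Continuity of division at `(a, b)` and a union bound. -/
lemma tendstoInMeasure_div_const {Ω ι : Type*} [MeasurableSpace Ω] {P : Measure Ω}
    {l : Filter ι} {X Y : ι → Ω → ℝ} {a b : ℝ} (hb : b ≠ 0)
    (hX : TendstoInMeasure P X l fun _ => a) (hY : TendstoInMeasure P Y l fun _ => b) :
    TendstoInMeasure P (fun i ω => X i ω / Y i ω) l fun _ => a / b := by
  rw [tendstoInMeasure_iff_dist] at *
  intro ε hε
  have hc : ContinuousAt (fun z : ℝ × ℝ => z.1 / z.2) (a, b) :=
    continuousAt_fst.div continuousAt_snd hb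
  obtain ⟨δ, hδ, hδε⟩ := Metric.continuousAt_iff.1 hc ε hε
  have h := (hX δ hδ).add (hY δ hδ)
  rw [add_zero] at h
  refine tendsto_of_tendsto_of_tendsto_of_le_of_le tendsto_const_nhds h
    (fun _ => zero_le) fun i => (measure_mono ?_).trans (measure_union_le _ _)
  intro ω hω
  by_contra hcon
  simp only [Set.mem_union, Set.mem_ofPred_eq, not_or, not_le] at hcon hω
  refine absurd (hδε (x := (X i ω, Y i ω)) ?_) (not_lt.2 hω)
  rw [Prod.dist_eq]
  exact max_lt hcon.1 hcon.2

lemma gaussAbsMoment_pos {f : Measure ℝ} {p : ℝ} (hp : 0 < p) (hf : 0 < Var[id; f]) :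
    0 < gaussAbsMoment f p := by
  have hv : (Var[id; f] ^ 2).toNNReal ≠ 0 := by
    rw [Ne, Real.toNNReal_eq_zero, not_le]; positivity
  have := nullSingletonClass_gaussianReal (μ := 0) hv
  have hi : Integrable (fun y : ℝ => |y| ^ p) (gaussianReal 0 (Var[id; f] ^ 2).toNNReal) :=
    (memLp_iff_integrable_abs_rpow hp aestronglyMeasurable_id).1
      (memLp_id_gaussianReal' _ (by simp))
  unfold gaussAbsMoment absMoment
  rw [integral_pos_iff_support_of_nonneg (fun _ => by positivity) hi]
  have hs : Function.support (fun y : ℝ => |y| ^ p) = {0}ᶜ := by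
    ext y
    simp [Real.rpow_eq_zero (abs_nonneg y) hp.ne']
  rw [hs, prob_compl_eq_one_sub (measurableSet_singleton 0), measure_singleton]
  simp

lemma lpNormVec_rpow {ι : Type*} [Fintype ι] {p : ℝ} (hp : 0 < p) (v : ι → ℝ) :
    lpNormVec p v ^ p = ∑ i, |v i| ^ p := by
  have h : (ENNReal.ofReal p).toReal = p := ENNReal.toReal_ofReal hp.le
  rw [lpNormVec, PiLp.norm_eq_sum (by rwa [h]), h]
  rw [← Real.rpow_mul (Finset.sum_nonneg fun _ _ => by positivity), one_div,
    inv_mul_cancel₀ hp.ne', Real.rpow_one]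
  simp

lemma queryFactor_div_eq {m n : ℕ} (hm : 0 < m) (hn : 0 < n) {p : ℝ} (hp : 0 < p)
    (A : Matrix (Fin m) (Fin n) ℝ) (x : Fin n → ℝ) :
    queryFactor p A x / (n : ℝ) ^ (p / 2)
      = ((n : ℝ)⁻¹ * ∑ j, |x j| ^ p * ((m : ℝ)⁻¹ * ∑ i, |A i j| ^ p))
        / ((m : ℝ)⁻¹ * ∑ i, |(√(n : ℝ))⁻¹ * ∑ j, A i j * x j| ^ p) := by
  have hm0 : (0 : ℝ) < m := by exact_mod_cast hm
  have hn0 : (0 : ℝ) < n := by exact_mod_cast hn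
  have e1 : ∀ i, |(√(n : ℝ))⁻¹ * ∑ j, A i j * x j| ^ p
      = ((n : ℝ) ^ (p / 2))⁻¹ * |∑ j, A i j * x j| ^ p := by
    intro i
    rw [abs_mul, Real.mul_rpow (abs_nonneg _) (abs_nonneg _), abs_inv,
      abs_of_nonneg (Real.sqrt_nonneg _), Real.inv_rpow (Real.sqrt_nonneg _), Real.sqrt_eq_rpow,
      ← Real.rpow_mul hn0.le]
    congr 3; ring
  -- One `n^(p/2)` cancels the normalisation, the other rescales `Ax`, and `n⁻¹` averages over the
  -- columns.
  have e2 : (n : ℝ) ^ (p - 1) = (n : ℝ) ^ (p / 2) * (n : ℝ) ^ (p / 2) * (n : ℝ)⁻¹ := by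
    rw [← Real.rpow_add hn0, add_halves, Real.rpow_sub_one hn0.ne', div_eq_mul_inv]
  have e3 : ∀ j, lpNormVec p (x j • A.col j) ^ p = |x j| ^ p * ∑ i, |A i j| ^ p := by
    intro j
    rw [lpNormVec_rpow hp, Finset.mul_sum]
    refine Finset.sum_congr rfl fun i _ => ?_
    rw [Pi.smul_apply, smul_eq_mul, abs_mul, Real.mul_rpow (abs_nonneg _) (abs_nonneg _)]
    rfl
  have e4 : lpNormVec p (A *ᵥ x) ^ p = ∑ i, |∑ j, A i j * x j| ^ p := by
    rw [lpNormVec_rpow hp]; rfl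
  simp_rw [queryFactor, e1, e2, e3, e4, ← Finset.mul_sum, mul_left_comm _ ((m : ℝ)⁻¹),
    ← Finset.mul_sum]
  have hr : 0 < (n : ℝ) ^ (p / 2) := by positivity
  -- If `Ax = 0`, both sides are `0` by division by zero, matching the convention `M(p) = 0`.
  rcases eq_or_ne (∑ i, |∑ j, A i j * x j| ^ p) 0 with h | h
  · simp [h]
  · field_simp

theorem mainTheorem2
    (f : Measure ℝ) [IsProbabilityMeasure f]
    (p : ℝ) (hp : 1 ≤ p)
    (hf_sq : MemLp id 2 f) (hf_p : MemLp id (ENNReal.ofReal p) f)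
    (hf_mean : ∫ y, y ∂f = 0) (hf_var : 0 < Var[id; f])
    {Ω : Type*} [MeasurableSpace Ω] (P : Measure Ω) [IsProbabilityMeasure P]
    (A : ∀ m n : ℕ, Ω → Matrix (Fin m) (Fin n) ℝ) (x : ∀ m n : ℕ, Ω → Fin n → ℝ)
    (hAx : ∀ m n : ℕ, IIDEntries P f (A m n) (x m n)) :
    TendstoInMeasure P
      (fun (mn : ℕ × ℕ) (ω : Ω) =>
        queryFactor p (A mn.1 mn.2 ω) (x mn.1 mn.2 ω) / (mn.2 : ℝ) ^ (p / 2))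
      (atTop ×ˢ atTop)
      (fun _ => absMoment f p ^ 2 / gaussAbsMoment f p) := by
  have hp0 : 0 < p := by linarith
  have hφm : Measurable fun y : ℝ => |y| ^ p := measurable_id.abs.pow_const p
  have hφ : Integrable (fun y : ℝ => |y| ^ p) f :=
    (memLp_iff_integrable_abs_rpow hp0 hf_p.1).1 hf_p
  have hφ0 : ∀ y : ℝ, 0 ≤ |y| ^ p := fun y => by positivity
  have hpos : ∀ᶠ mn : ℕ × ℕ in atTop ×ˢ atTop, 0 < mn.1 ∧ 0 < mn.2 :=
    (eventually_gt_atTop 0).prod_mk (eventually_gt_atTop 0)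
  have hnum : TendstoInMeasure P (fun (mn : ℕ × ℕ) ω => (mn.2 : ℝ)⁻¹ * ∑ j,
      |x mn.1 mn.2 ω j| ^ p * ((mn.1 : ℝ)⁻¹ * ∑ i, |A mn.1 mn.2 ω i j| ^ p))
      (atTop ×ˢ atTop) fun _ => absMoment f p ^ 2 := by
    refine tendstoInMeasure_of_tendsto_integral_abs ?_ ?_
    · filter_upwards [hpos] with mn hmn
      exact ((hAx mn.1 mn.2).integral_abs_numerator_sub_le hφm hφ hφ0 hmn.2).1
    · have hdev := tendsto_averageDeviation hφm hφ
      have hlim := ((hdev.comp (tendsto_fst (f := atTop) (g := atTop (α := ℕ)))).const_mul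
        (absMoment f p)).add ((hdev.comp (tendsto_snd (f := atTop (α := ℕ)) (g := atTop))).const_mul
        (absMoment f p))
      rw [mul_zero, add_zero] at hlim
      refine squeeze_zero' (Eventually.of_forall fun _ => integral_nonneg fun _ => abs_nonneg _)
        ?_ hlim
      filter_upwards [hpos] with mn hmn
      exact ((hAx mn.1 mn.2).integral_abs_numerator_sub_le hφm hφ hφ0 hmn.2).2
  have hden : TendstoInMeasure P (fun (mn : ℕ × ℕ) ω => (mn.1 : ℝ)⁻¹ * ∑ i : Fin mn.1,
      |(√(mn.2 : ℝ))⁻¹ * ∑ j, A mn.1 mn.2 ω i j * x mn.1 mn.2 ω j| ^ p)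
      (atTop ×ˢ atTop) fun _ => gaussAbsMoment f p :=
    tendstoInMeasure_of_tendsto_integral_abs (Eventually.of_forall fun mn =>
      (integrable_finsetSum _ fun i _ =>
        (hAx mn.1 mn.2).integrable_row_sum hp0 hf_p i).const_mul _)
      (tendsto_integral_abs_average_rows hp hf_sq hf_p hf_mean hAx)
  refine (tendstoInMeasure_div_const (gaussAbsMoment_pos hp0 hf_var).ne' hnum hden).congr' ?_ ae_eq_rfl
  filter_upwards [hpos] with mn hmn
  exact ae_of_all _ fun ω => (queryFactor_div_eq hmn.1 hmn.2 hp0 _ _).symm
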